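/- Let $N\ge 1$, let $d_0,d_1,\dots,d_N$ be positive integers and let $\Phi\in\mathbb{R}^{d_N\times d_0}$. For $W_j\in\mathbb{R}^{d_j\times d_{j-1}}$ ($j=1,\dots,N$) write $W_{1:N}:=W_NW_{N-1}\cdots W_1$ and $$L^N(W_1,\dots,W_N):=\tfrac12\,\|W_NW_{N-1}\cdots W_1-\Phi\|_F^2 .$$ Consider gradient descent with learning rate $\eta>0$, $$W_j(t+1)=W_j(t)-\eta\,\frac{\partial L^N}{\partial W_j}\big(W_1(t),\dots,W_N(t)\big),\qquad j=1,\dots,N,\ t=0,1,2,\dots,$$ and let $\ell(t):=L^N(W_1(t),\dots,W_N(t))$. Let $c>0$ and assume: (i) the initial end-to-end matrix has deficiency margin $c$ with respect to $\Phi$, i.e. $\|W_{1:N}(0)-\Phi\|_F\le\sigma_{\min}(\Phi)-c$, where $\sigma_{\min}(\Phi)$ is the $\min\{d_0,d_N\}$-th largest singular value of $\Phi$; (ii) the initial weights are $\delta$-balanced, i.e. $\|W_{j+1}(0)^\top W_{j+1}(0)-W_j(0)W_j(0)^\top\|_F\le\delta$ for all $j\in\{1,\dots,N-1\}$, with $\delta=\dfrac{c^2}{256\,N^3\,\|\Phi\|_F^{2(N-1)/N}}$;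 (iii) $\eta\le\dfrac{c^{(4N-2)/N}}{6144\,N^3\,\|\Phi\|_F^{(6N-4)/N}}$. Then for every $\epsilon>0$ and every iteration $T\in\{0,1,2,\dots\}$ with $$T\ \ge\ \frac{1}{\eta\, c^{2(N-1)/N}}\,\log\!\left(\frac{\ell(0)}{\epsilon}\right)$$ (a condition met by every $T$ if $\ell(0)=0$), one has $\ell(T)\le\epsilon$. -/

import Mathlib

/-- The Frobenius norm of a real matrix. -/
noncomputable def frobNorm {m n : ℕ} (A : Matrix (Fin m) (Fin n) ℝ) : ℝ :=
  letI := Matrix.frobeniusNormedAddCommGroup (m := Fin m) (n := Fin n) (α := ℝ)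
  ‖A‖

/-- `σ_min(A)`: the `min {m, n}`-th largest singular value of an `m × n` matrix. Mathlib lists the
singular values in non-increasing order, starting with index `0`. (If `min {m, n} = 0`, this is
`0`.) -/
noncomputable def sigmaMin {m n : ℕ} (A : Matrix (Fin m) (Fin n) ℝ) : ℝ :=
  (Matrix.toEuclideanLin A).singularValues (min m n - 1)

/-- The weights of a depth-`N` linear network with widths `d 0, d 1, …, d N` (the values of `d`
beyond `N` play no role). The entry with index `j : Fin N`, counted from `0`, is the matrix usually
called `W_{j+1}`, of size `d (j+1) × d j`. -/
abbrev Weights (d : ℕ → ℕ) (N : ℕ) : Type :=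
  (j : Fin N) → Matrix (Fin (d (j + 1))) (Fin (d j)) ℝ

/-- The product `W_k W_{k-1} ⋯ W_1` of the first `k` layers (the identity for `k = 0`). -/
noncomputable def layerProd {d : ℕ → ℕ} {N : ℕ} (W : Weights d N) :
    (k : ℕ) → k ≤ N → Matrix (Fin (d k)) (Fin (d 0)) ℝ
  | 0, _ => 1
  | k + 1, h => W ⟨k, h⟩ * layerProd W k (Nat.le_of_succ_le h)

/-- The end-to-end matrix `W_{1:N} = W_N W_{N-1} ⋯ W_1`. -/
noncomputable def endToEnd {d : ℕ → ℕ} {N : ℕ} (W : Weights d N) :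
    Matrix (Fin (d N)) (Fin (d 0)) ℝ :=
  layerProd W N le_rfl

/-- The objective `L^N(W_1, …, W_N) = ½ ‖W_N ⋯ W_1 - Φ‖_F²`. -/
noncomputable def loss {d : ℕ → ℕ} {N : ℕ} (Φ : Matrix (Fin (d N)) (Fin (d 0)) ℝ)
    (W : Weights d N) : ℝ :=
  (1 / 2) * frobNorm (endToEnd W - Φ) ^ 2

/-- The matrix of partial derivatives `∂L^N/∂W_j` at `W`: its `(a, b)` entry is the derivative of
the objective with respect to the `(a, b)` entry of the `j`-th weight matrix. The objective is a
polynomial in the entries, so all these derivatives exist. -/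
noncomputable def lossGrad {d : ℕ → ℕ} {N : ℕ} (Φ : Matrix (Fin (d N)) (Fin (d 0)) ℝ)
    (W : Weights d N) (j : Fin N) : Matrix (Fin (d (j + 1))) (Fin (d j)) ℝ :=
  Matrix.of fun a b =>
    deriv (fun s : ℝ => loss Φ (Function.update W j (W j + s • Matrix.single a b 1))) 0

/-- `W 0, W 1, W 2, …` are iterates of gradient descent with learning rate `η` on the objective. -/
def IsGradientDescent {d : ℕ → ℕ} {N : ℕ} (Φ : Matrix (Fin (d N)) (Fin (d 0)) ℝ) (η : ℝ)
    (W : ℕ → Weights d N) : Prop :=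
  ∀ (t : ℕ) (j : Fin N), W (t + 1) j = W t j - η • lossGrad Φ (W t) j

/-- `δ`-balancedness: `‖W_{j+1}ᵀ W_{j+1} - W_j W_jᵀ‖_F ≤ δ` for all pairs of consecutive layers. -/
def IsBalanced {d : ℕ → ℕ} {N : ℕ} (δ : ℝ) (W : Weights d N) : Prop :=
  ∀ (j : ℕ) (h : j + 1 < N),
    frobNorm ((W ⟨j + 1, h⟩).transpose * W ⟨j + 1, h⟩
      - W ⟨j, Nat.lt_of_succ_lt h⟩ * (W ⟨j, Nat.lt_of_succ_lt h⟩).transpose) ≤ δ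

/-- `W` has deficiency margin `c` with respect to the target `Φ`. -/
def HasDeficiencyMargin {m n : ℕ} (c : ℝ) (Φ W : Matrix (Fin m) (Fin n) ℝ) : Prop :=
  frobNorm (W - Φ) ≤ sigmaMin Φ - c

/-!
Write `N = n + 1`, `W = W_N ⋯ W_1`, `E = W - Φ`, and let `G_j = (W_N ⋯ W_{j+1})ᵀ E (W_{j-1} ⋯ W_1)ᵀ`
be the gradient with respect to `W_j`. The proof rests on the quantity `S = ∑ ‖G_j‖_F²`.

* *Decrease.* The first-order change of `½ ‖E‖_F²` in one step is `-η S`, and the higher-order terms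
  of the product `∏ (W_j - η G_j)` are at most a small multiple of `η S`, provided that the layers
  have norms of order `‖Φ‖_F ^ (1 / N)`. Hence `‖E‖_F²` drops by at least `3/2 η S`
  (`frobNorm_residual_step_sq_le`).
* *Balancedness.* Since `W_{j+1}ᵀ G_{j+1} = G_j W_jᵀ`, the differences
  `W_{j+1}ᵀ W_{j+1} - W_j W_jᵀ` change only to second order, by at most `η² S` per step
  (`frobNorm_balance_step_le`). By the previous point the total change is at most
  `2/3 η ‖E(0)‖_F² ≤ δ`, so that the weights stay `2δ`-balanced forever.
* *Size and rank of the layers.* For nearly balanced weights, `W Wᵀ` is close to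
  `(W_N W_Nᵀ) ^ N`, and `(W_N ⋯ W_2) (W_N ⋯ W_2)ᵀ` is close to `(W_N W_Nᵀ) ^ (N - 1)`
  (`opNorm_gram_layerSegment_sub_pow_le`). The former bounds the norms of the layers
  (`opNorm_sq_pow_le_of_balanced`). If `d_N ≤ d_0`, the deficiency margin gives `W Wᵀ ≥ c²`, so that
  both facts together give `(W_N ⋯ W_2) (W_N ⋯ W_2)ᵀ ≥ 3/4 c ^ (2 (N - 1) / N)` and
  `S ≥ ‖G_1‖_F² ≥ 3/4 c ^ (2 (N - 1) / N) ‖E‖_F²`. If `d_0 ≤ d_N`, the reversed network is treated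
  in the same way, with `G_N` in place of `G_1` (`le_sum_frobNorm_layerGrad_sq`).

Combining these, `‖E‖_F²` decreases by the factor `1 - η c ^ (2 (N - 1) / N)` in each step
(`frobNorm_residual_sq_le_pow_mul`).

To avoid matrices whose sizes depend on the layer, all weights are padded with zeros to square
matrices of a common size; the ranges of the original spaces are then described by projections.
Layers are counted from `0`, so that the layers are `w 0, …, w n`. Below, `‖·‖` is the operator norm
for the Euclidean norm, and `x = c ^ (2 / N)`, `y = ‖Φ‖_F ^ (2 / N)`, which turns all real powers of
the theorem into natural powers.
-/

open Matrix
open scoped Matrix.Norms.L2Operator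

/-! ### The Frobenius norm and the operator norm -/

section FrobeniusNorm

variable {m n : ℕ}

theorem frobNorm_nonneg (A : Matrix (Fin m) (Fin n) ℝ) : 0 ≤ frobNorm A :=
  letI := Matrix.frobeniusNormedAddCommGroup (m := Fin m) (n := Fin n) (α := ℝ)
  norm_nonneg A

theorem frobNorm_add_le (A B : Matrix (Fin m) (Fin n) ℝ) :
    frobNorm (A + B) ≤ frobNorm A + frobNorm B :=
  letI := Matrix.frobeniusNormedAddCommGroup (m := Fin m) (n := Fin n) (α := ℝ)
  norm_add_le A B

theorem frobNorm_neg (A : Matrix (Fin m) (Fin n) ℝ) : frobNorm (-A) = frobNorm A :=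
  letI := Matrix.frobeniusNormedAddCommGroup (m := Fin m) (n := Fin n) (α := ℝ)
  norm_neg A

theorem frobNorm_sub_le (A B : Matrix (Fin m) (Fin n) ℝ) :
    frobNorm (A - B) ≤ frobNorm A + frobNorm B := by
  simpa [sub_eq_add_neg, frobNorm_neg] using frobNorm_add_le A (-B)

theorem frobNorm_sum_le {κ : Type*} (s : Finset κ) (f : κ → Matrix (Fin m) (Fin n) ℝ) :
    frobNorm (∑ i ∈ s, f i) ≤ ∑ i ∈ s, frobNorm (f i) :=
  letI := Matrix.frobeniusNormedAddCommGroup (m := Fin m) (n := Fin n) (α := ℝ)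
  norm_sum_le s f

theorem frobNorm_smul (r : ℝ) (A : Matrix (Fin m) (Fin n) ℝ) :
    frobNorm (r • A) = |r| * frobNorm A :=
  letI := Matrix.frobeniusNormedAddCommGroup (m := Fin m) (n := Fin n) (α := ℝ)
  letI := Matrix.frobeniusNormedSpace (m := Fin m) (n := Fin n) (α := ℝ) (R := ℝ)
  norm_smul r A

theorem frobNorm_transpose (A : Matrix (Fin m) (Fin n) ℝ) : frobNorm Aᵀ = frobNorm A :=
  Matrix.frobenius_norm_transpose A

theorem frobNorm_sq_eq_sum (A : Matrix (Fin m) (Fin n) ℝ) :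
    frobNorm A ^ 2 = ∑ i, ∑ j, A i j ^ 2 := by
  have h := Matrix.frobenius_norm_def A
  have h' : frobNorm A = (∑ i, ∑ j, A i j ^ 2) ^ (1 / 2 : ℝ) := by
    refine h.trans ?_
    simp
  rw [h', ← Real.sqrt_eq_rpow, Real.sq_sqrt]
  positivity

theorem trace_transpose_mul_eq_sum (A B : Matrix (Fin m) (Fin n) ℝ) :
    (Aᵀ * B).trace = ∑ i, ∑ j, A i j * B i j := by
  rw [Finset.sum_comm]
  simp [Matrix.trace, Matrix.mul_apply]

/-- The square of the Frobenius norm comes from the inner product `tr (Aᵀ B)`. -/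
theorem frobNorm_sq (A : Matrix (Fin m) (Fin n) ℝ) : frobNorm A ^ 2 = (Aᵀ * A).trace := by
  rw [frobNorm_sq_eq_sum, trace_transpose_mul_eq_sum]
  simp only [sq]

theorem frobNorm_add_sq (A B : Matrix (Fin m) (Fin n) ℝ) :
    frobNorm (A + B) ^ 2 = frobNorm A ^ 2 + 2 * (Aᵀ * B).trace + frobNorm B ^ 2 := by
  simp only [frobNorm_sq_eq_sum, trace_transpose_mul_eq_sum, Finset.mul_sum,
    ← Finset.sum_add_distrib, Matrix.add_apply]
  refine Finset.sum_congr rfl fun i _ => Finset.sum_congr rfl fun j _ => by ring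

theorem trace_transpose_mul_le (A B : Matrix (Fin m) (Fin n) ℝ) :
    (Aᵀ * B).trace ≤ frobNorm A * frobNorm B := by
  refine le_of_sq_le_sq ?_ (mul_nonneg (frobNorm_nonneg A) (frobNorm_nonneg B))
  rw [mul_pow, frobNorm_sq_eq_sum, frobNorm_sq_eq_sum, trace_transpose_mul_eq_sum]
  simp only [← Finset.sum_product']
  exact Finset.sum_mul_sq_le_sq_mul_sq _ _ _

theorem dotProduct_self_eq_norm_sq (v : Fin n → ℝ) : v ⬝ᵥ v = ‖WithLp.toLp 2 v‖ ^ 2 := by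
  rw [EuclideanSpace.norm_sq_eq]
  simp [dotProduct, sq]

theorem norm_toLp_mulVec_le (A : Matrix (Fin m) (Fin n) ℝ) (v : Fin n → ℝ) :
    ‖WithLp.toLp 2 (A *ᵥ v)‖ ≤ ‖A‖ * ‖WithLp.toLp 2 v‖ :=
  A.l2_opNorm_mulVec (WithLp.toLp 2 v)

theorem frobNorm_sq_eq_sum_col (A : Matrix (Fin m) (Fin n) ℝ) :
    frobNorm A ^ 2 = ∑ j, (fun i => A i j) ⬝ᵥ (fun i => A i j) := by
  rw [frobNorm_sq_eq_sum, Finset.sum_comm]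
  simp [dotProduct, sq]

theorem mul_col {k : ℕ} (A : Matrix (Fin k) (Fin m) ℝ) (B : Matrix (Fin m) (Fin n) ℝ) (j : Fin n) :
    (fun i => (A * B) i j) = A *ᵥ fun i => B i j := by
  ext i; simp [Matrix.mul_apply, Matrix.mulVec, dotProduct]

theorem frobNorm_mul_le_opNorm_mul {k : ℕ} (A : Matrix (Fin k) (Fin m) ℝ)
    (B : Matrix (Fin m) (Fin n) ℝ) : frobNorm (A * B) ≤ ‖A‖ * frobNorm B := by
  refine le_of_sq_le_sq ?_ (mul_nonneg (norm_nonneg A) (frobNorm_nonneg B))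
  rw [mul_pow, frobNorm_sq_eq_sum_col, frobNorm_sq_eq_sum_col, Finset.mul_sum]
  refine Finset.sum_le_sum fun j _ => ?_
  rw [mul_col, dotProduct_self_eq_norm_sq, dotProduct_self_eq_norm_sq, ← mul_pow]
  exact pow_le_pow_left₀ (norm_nonneg _) (norm_toLp_mulVec_le _ _) 2

theorem opNorm_transpose (A : Matrix (Fin m) (Fin n) ℝ) : ‖Aᵀ‖ = ‖A‖ := by
  rw [← conjTranspose_eq_transpose_of_trivial, l2_opNorm_conjTranspose]

theorem frobNorm_mul_le_mul_opNorm {k : ℕ} (A : Matrix (Fin k) (Fin m) ℝ)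
    (B : Matrix (Fin m) (Fin n) ℝ) : frobNorm (A * B) ≤ frobNorm A * ‖B‖ := by
  have h := frobNorm_mul_le_opNorm_mul Bᵀ Aᵀ
  rwa [← transpose_mul, frobNorm_transpose, frobNorm_transpose, opNorm_transpose, mul_comm] at h

theorem opNorm_le_frobNorm (A : Matrix (Fin m) (Fin n) ℝ) : ‖A‖ ≤ frobNorm A := by
  refine ContinuousLinearMap.opNorm_le_bound _ (frobNorm_nonneg A) fun v => ?_
  refine le_of_sq_le_sq ?_ (mul_nonneg (frobNorm_nonneg A) (norm_nonneg v))
  have h : ‖WithLp.toLp 2 (A *ᵥ v.ofLp)‖ ^ 2 ≤ (frobNorm A * ‖v‖) ^ 2 := by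
    rw [mul_pow, frobNorm_sq_eq_sum, Finset.sum_mul, EuclideanSpace.norm_sq_eq,
      EuclideanSpace.norm_sq_eq]
    refine Finset.sum_le_sum fun i _ => ?_
    simpa [Matrix.mulVec, dotProduct] using
      Finset.sum_mul_sq_le_sq_mul_sq Finset.univ (A i) v.ofLp
  exact h

theorem frobNorm_mul_le (A : Matrix (Fin m) (Fin n) ℝ) {k : ℕ} (B : Matrix (Fin n) (Fin k) ℝ) :
    frobNorm (A * B) ≤ frobNorm A * frobNorm B :=
  (frobNorm_mul_le_mul_opNorm A B).trans
    (mul_le_mul_of_nonneg_left (opNorm_le_frobNorm B) (frobNorm_nonneg A))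

theorem opNorm_mul_transpose_self (A : Matrix (Fin m) (Fin n) ℝ) : ‖A * Aᵀ‖ = ‖A‖ ^ 2 := by
  have h := l2_opNorm_conjTranspose_mul_self Aᵀ
  rwa [conjTranspose_eq_transpose_of_trivial, transpose_transpose, opNorm_transpose, ← sq] at h

theorem opNorm_transpose_mul_self (A : Matrix (Fin m) (Fin n) ℝ) : ‖Aᵀ * A‖ = ‖A‖ ^ 2 := by
  have h := opNorm_mul_transpose_self Aᵀ
  rwa [transpose_transpose, opNorm_transpose] at h

theorem opNorm_one_le : ‖(1 : Matrix (Fin m) (Fin m) ℝ)‖ ≤ 1 := by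
  rw [← diagonal_one, l2_opNorm_diagonal]
  exact (pi_norm_le_iff_of_nonneg zero_le_one).2 fun i => by simp

theorem opNorm_pow_le {A : Matrix (Fin m) (Fin m) ℝ} {M : ℝ} (hM : ‖A‖ ≤ M) (k : ℕ) :
    ‖A ^ k‖ ≤ M ^ k := by
  have hM0 : 0 ≤ M := (norm_nonneg A).trans hM
  induction k with
  | zero => simpa using opNorm_one_le
  | succ k ih =>
    rw [pow_succ, pow_succ]
    exact (norm_mul_le _ _).trans (mul_le_mul ih hM (norm_nonneg _) (by positivity))

/-- The operator norm of a symmetric matrix is power-multiplicative: this follows from the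
`C⋆`-identity for exponents `2 ^ k`, and from submultiplicativity for the others. -/
theorem pow_opNorm_le_of_isHermitian {A : Matrix (Fin m) (Fin m) ℝ} (hA : A.IsHermitian) {k : ℕ}
    (hk0 : k ≠ 0) : ‖A‖ ^ k ≤ ‖A ^ k‖ := by
  rcases (norm_nonneg A).eq_or_lt with h0 | h0
  · simp [← h0, hk0]
  · have hk : k < 2 ^ k := Nat.lt_two_pow_self
    have h := IsSelfAdjoint.norm_pow_two_pow (x := A) hA k
    have h2 : A ^ (2 ^ k) = A ^ k * A ^ (2 ^ k - k) := by rw [← pow_add]; congr 1; omega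
    have h3 : ‖A‖ ^ (2 ^ k) = ‖A‖ ^ k * ‖A‖ ^ (2 ^ k - k) := by rw [← pow_add]; congr 1; omega
    have h4 := norm_mul_le (A ^ k) (A ^ (2 ^ k - k))
    rw [← h2, h, h3] at h4
    have h5 := h4.trans (mul_le_mul_of_nonneg_left (opNorm_pow_le le_rfl (2 ^ k - k))
      (norm_nonneg _))
    exact le_of_mul_le_mul_right h5 (by positivity)

theorem abs_dotProduct_mulVec_le (A : Matrix (Fin m) (Fin m) ℝ) (v : Fin m → ℝ) :
    |v ⬝ᵥ A *ᵥ v| ≤ ‖A‖ * (v ⬝ᵥ v) := by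
  have h := abs_real_inner_le_norm (WithLp.toLp 2 v) (toEuclideanCLM (𝕜 := ℝ) A (WithLp.toLp 2 v))
  rw [inner_toEuclideanCLM, toEuclideanCLM_toLp] at h
  refine h.trans ?_
  rw [dotProduct_self_eq_norm_sq]
  nlinarith [norm_toLp_mulVec_le A v, norm_nonneg (WithLp.toLp 2 v)]

theorem opNorm_pow_sub_pow_le {X Y : Matrix (Fin m) (Fin m) ℝ} {M δ : ℝ} (hX : ‖X‖ ≤ M)
    (hY : ‖Y‖ ≤ M) (hXY : ‖X - Y‖ ≤ δ) (k : ℕ) :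
    ‖X ^ (k + 1) - Y ^ (k + 1)‖ ≤ (k + 1) * δ * M ^ k := by
  have hM : 0 ≤ M := (norm_nonneg X).trans hX
  have hδ : 0 ≤ δ := (norm_nonneg _).trans hXY
  induction k with
  | zero => simpa using hXY
  | succ k ih =>
    have e : X ^ (k + 1 + 1) - Y ^ (k + 1 + 1)
        = X ^ (k + 1) * (X - Y) + (X ^ (k + 1) - Y ^ (k + 1)) * Y := by
      rw [pow_succ X (k + 1), pow_succ Y (k + 1)]; noncomm_ring
    rw [e]
    calc _ ≤ ‖X ^ (k + 1)‖ * ‖X - Y‖ + ‖X ^ (k + 1) - Y ^ (k + 1)‖ * ‖Y‖ :=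
          (norm_add_le _ _).trans (add_le_add (norm_mul_le _ _) (norm_mul_le _ _))
      _ ≤ M ^ (k + 1) * δ + (k + 1) * δ * M ^ k * M := by
          gcongr
          exact opNorm_pow_le hX _
      _ = _ := by push_cast; ring

end FrobeniusNorm

/-! ### Products of consecutive layers -/

section SegmentProducts

variable {m : ℕ}

/-- The product `w (b - 1) * ⋯ * w a` of the layers `a, …, b - 1` of a network all of whose layers
have the same width. It is `1` if `b ≤ a`. -/
noncomputable def layerSegment (w : ℕ → Matrix (Fin m) (Fin m) ℝ) (a : ℕ) :
    ℕ → Matrix (Fin m) (Fin m) ℝ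
  | 0 => 1
  | b + 1 => if a ≤ b then w b * layerSegment w a b else 1

theorem layerSegment_of_le (w : ℕ → Matrix (Fin m) (Fin m) ℝ) {a b : ℕ} (h : b ≤ a) :
    layerSegment w a b = 1 := by
  cases b with
  | zero => rfl
  | succ b => simp [layerSegment, show ¬ a ≤ b by omega]

theorem layerSegment_succ_right (w : ℕ → Matrix (Fin m) (Fin m) ℝ) {a b : ℕ} (h : a ≤ b) :
    layerSegment w a (b + 1) = w b * layerSegment w a b := by
  simp [layerSegment, h]

theorem layerSegment_succ_left (w : ℕ → Matrix (Fin m) (Fin m) ℝ) {a b : ℕ} (h : a < b) :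
    layerSegment w a b = layerSegment w (a + 1) b * w a := by
  induction b, h using Nat.le_induction with
  | base => simp [layerSegment_succ_right, layerSegment_of_le]
  | succ b h ih =>
    rw [layerSegment_succ_right w (by omega), layerSegment_succ_right w (by omega), ih, mul_assoc]

theorem layerSegment_congr {w w' : ℕ → Matrix (Fin m) (Fin m) ℝ} {a b : ℕ}
    (h : ∀ j, a ≤ j → j < b → w j = w' j) : layerSegment w a b = layerSegment w' a b := by
  induction b with
  | zero => rfl
  | succ b ih =>
    by_cases hab : a ≤ b
    · rw [layerSegment_succ_right _ hab, layerSegment_succ_right _ hab, h b hab (by omega),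
        ih fun j h1 h2 => h j h1 (by omega)]
    · rw [layerSegment_of_le _ (by omega), layerSegment_of_le _ (by omega)]

/-- Reversing and transposing the network transposes its segment products. -/
theorem layerSegment_reverse (w : ℕ → Matrix (Fin m) (Fin m) ℝ) (n : ℕ) {a b : ℕ} (hab : a ≤ b)
    (hb : b ≤ n + 1) :
    layerSegment (fun j => (w (n - j))ᵀ) a b = (layerSegment w (n + 1 - b) (n + 1 - a))ᵀ := by
  induction b, hab using Nat.le_induction with
  | base => simp [layerSegment_of_le]
  | succ b h ih =>
    rw [layerSegment_succ_right _ h, ih (by omega),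
      layerSegment_succ_left w (show n + 1 - (b + 1) < n + 1 - a by omega), transpose_mul]
    congr 2
    · congr 1; omega
    · rw [show n + 1 - (b + 1) + 1 = n + 1 - b by omega]

theorem opNorm_layerSegment_le {w : ℕ → Matrix (Fin m) (Fin m) ℝ} {a b : ℕ} {s : ℝ} (hs : 0 ≤ s)
    (h : ∀ j, a ≤ j → j < b → ‖w j‖ ≤ s) : ‖layerSegment w a b‖ ≤ s ^ (b - a) := by
  induction b with
  | zero => simpa [layerSegment] using opNorm_one_le
  | succ b ih =>
    by_cases hab : a ≤ b
    · rw [layerSegment_succ_right _ hab, show b + 1 - a = (b - a) + 1 by omega, pow_succ']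
      exact (norm_mul_le _ _).trans (mul_le_mul (h b hab (by omega))
        (ih fun j h1 h2 => h j h1 (by omega)) (norm_nonneg _) hs)
    · rw [layerSegment_of_le _ (by omega), show b + 1 - a = 0 by omega, pow_zero]
      exact opNorm_one_le

/-- The telescoping identity for the difference of two products. -/
theorem layerSegment_sub_layerSegment (w w' : ℕ → Matrix (Fin m) (Fin m) ℝ) (b : ℕ) :
    layerSegment w' 0 b - layerSegment w 0 b
      = ∑ j ∈ Finset.range b, layerSegment w (j + 1) b * (w' j - w j) * layerSegment w' 0 j := by
  induction b with
  | zero => simp [layerSegment]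
  | succ b ih =>
    rw [Finset.sum_range_succ, layerSegment_of_le w le_rfl, one_mul,
      layerSegment_succ_right w b.zero_le, layerSegment_succ_right w' b.zero_le]
    have e : ∑ j ∈ Finset.range b,
        layerSegment w (j + 1) (b + 1) * (w' j - w j) * layerSegment w' 0 j
        = w b * (layerSegment w' 0 b - layerSegment w 0 b) := by
      rw [ih, Finset.mul_sum]
      refine Finset.sum_congr rfl fun j hj => ?_
      rw [layerSegment_succ_right w (Finset.mem_range.1 hj)]
      noncomm_ring
    rw [e]
    noncomm_ring

/-- If consecutive layers are nearly balanced, then the Gram matrix of the last layers is nearly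
a power of the Gram matrix of the very last layer: one replaces `w j * (w j)ᵀ` by
`(w (j + 1))ᵀ * w (j + 1)`, starting from the innermost factor. -/
theorem opNorm_gram_layerSegment_sub_pow_le {w : ℕ → Matrix (Fin m) (Fin m) ℝ} {n a : ℕ} {M δ : ℝ}
    (ha : a ≤ n) (hδ : 0 ≤ δ) (hM : ∀ j ≤ n, ‖w j‖ ^ 2 ≤ M)
    (hbal : ∀ j < n, ‖(w (j + 1))ᵀ * w (j + 1) - w j * (w j)ᵀ‖ ≤ δ) :
    ‖layerSegment w a (n + 1) * (layerSegment w a (n + 1))ᵀ - (w n * (w n)ᵀ) ^ (n - a + 1)‖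
      ≤ (n - a : ℕ) ^ 2 * δ * M ^ (n - a) := by
  have hM0 : 0 ≤ M := (sq_nonneg _).trans (hM 0 (Nat.zero_le n))
  have key : ∀ k, a + k ≤ n →
      ‖layerSegment w a (n + 1) * (layerSegment w a (n + 1))ᵀ
        - layerSegment w (a + k + 1) (n + 1) * (w (a + k) * (w (a + k))ᵀ) ^ (k + 1)
          * (layerSegment w (a + k + 1) (n + 1))ᵀ‖ ≤ (k : ℝ) ^ 2 * δ * M ^ (n - a) := by
    intro k
    induction k with
    | zero =>
      intro h
      rw [layerSegment_succ_left w (show a < n + 1 by omega)]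
      simp [transpose_mul, mul_assoc]
    | succ k ih =>
      intro h
      have ih := ih (by omega)
      set A := layerSegment w (a + (k + 1) + 1) (n + 1) with hA
      have hA' : layerSegment w (a + k + 1) (n + 1) = A * w (a + k + 1) :=
        layerSegment_succ_left w (show a + k + 1 < n + 1 by omega)
      have hB : ‖layerSegment w (a + k + 1) (n + 1)‖ ^ 2 ≤ M ^ (n - a - k) := by
        have := opNorm_layerSegment_le (w := w) (a := a + k + 1) (b := n + 1)
          (Real.sqrt_nonneg M) fun j _ h2 => Real.le_sqrt_of_sq_le (hM j (by omega))
        rw [show n + 1 - (a + k + 1) = n - a - k by omega] at this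
        calc _ ≤ (√M ^ (n - a - k)) ^ 2 := by gcongr
          _ = M ^ (n - a - k) := by rw [← pow_mul, mul_comm, pow_mul, Real.sq_sqrt hM0]
      set B := layerSegment w (a + k + 1) (n + 1) with hBdef
      set X := w (a + k) * (w (a + k))ᵀ with hX
      have e1 : A * (w (a + (k + 1)) * (w (a + (k + 1)))ᵀ) ^ (k + 1 + 1) * Aᵀ
          = B * ((w (a + k + 1))ᵀ * w (a + k + 1)) ^ (k + 1) * Bᵀ := by
        have : ∀ (u : Matrix (Fin m) (Fin m) ℝ) (i : ℕ),
            (u * uᵀ) ^ (i + 1) = u * (uᵀ * u) ^ i * uᵀ := by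
          intro u i
          induction i with
          | zero => simp
          | succ i ih => rw [pow_succ, ih, pow_succ]; noncomm_ring
        rw [hA', transpose_mul, this, show a + (k + 1) = a + k + 1 by omega]
        noncomm_ring
      have e2 : ‖B * X ^ (k + 1) * Bᵀ - B * ((w (a + k + 1))ᵀ * w (a + k + 1)) ^ (k + 1) * Bᵀ‖
          ≤ (k + 1) * δ * M ^ (n - a) := by
        rw [← sub_mul, ← mul_sub]
        have hp := opNorm_pow_sub_pow_le (X := X) (Y := (w (a + k + 1))ᵀ * w (a + k + 1)) (M := M)
          (δ := δ) (by rw [hX, opNorm_mul_transpose_self]; exact hM _ (by omega))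
          (by rw [opNorm_transpose_mul_self]; exact hM _ (by omega))
          (by rw [norm_sub_rev]; exact hbal _ (by omega)) k
        calc _ ≤ ‖B‖ * ‖X ^ (k + 1) - ((w (a + k + 1))ᵀ * w (a + k + 1)) ^ (k + 1)‖ * ‖Bᵀ‖ :=
              (norm_mul_le _ _).trans (by gcongr; exact norm_mul_le _ _)
          _ = ‖B‖ ^ 2 * ‖X ^ (k + 1) - ((w (a + k + 1))ᵀ * w (a + k + 1)) ^ (k + 1)‖ := by
              rw [opNorm_transpose]; ring
          _ ≤ M ^ (n - a - k) * ((k + 1) * δ * M ^ k) := by gcongr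
          _ = (k + 1) * δ * M ^ (n - a) := by
              rw [show n - a = (n - a - k) + k by omega, pow_add,
                show n - a - k + k - k = n - a - k by omega]; ring
      rw [e1]
      calc _ ≤ (k : ℝ) ^ 2 * δ * M ^ (n - a) + (k + 1) * δ * M ^ (n - a) :=
            (norm_sub_le_norm_sub_add_norm_sub _ _ _).trans (add_le_add ih e2)
        _ = ((k : ℝ) ^ 2 + k + 1) * (δ * M ^ (n - a)) := by ring
        _ ≤ ((k + 1 : ℕ) : ℝ) ^ 2 * (δ * M ^ (n - a)) := by
            gcongr
            push_cast
            nlinarith [(Nat.cast_nonneg k : (0 : ℝ) ≤ k)]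
        _ = _ := by ring
  have h := key (n - a) (by omega)
  rwa [show a + (n - a) = n by omega, layerSegment_of_le w le_rfl, transpose_one, mul_one,
    one_mul] at h

end SegmentProducts

/-! ### Roots of lower bounds for positive semidefinite matrices -/

section SpectralBounds

variable {m : ℕ}

theorem posSemidef_mul_transpose (A : Matrix (Fin m) (Fin m) ℝ) : (A * Aᵀ).PosSemidef := by
  simpa using posSemidef_self_mul_conjTranspose A

/-- If `A ^ (n + 1) ≥ q x ^ (n + 1)` on the range of the projection `P`, where `A = P A` is positive
semidefinite and `q ≤ 1`, then `A ^ n ≥ q x ^ n` there: an eigenvalue `λ` with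
`λ ^ (n + 1) ≥ q x ^ (n + 1)` has `λ ^ n ≥ q x ^ n`. Eigenvectors for the eigenvalue `0` are
orthogonal to the range of `P`. -/
theorem mul_pow_le_dotProduct_pow_mulVec {A P : Matrix (Fin m) (Fin m) ℝ} (hA : A.PosSemidef)
    (hPT : Pᵀ = P) (hPP : P * P = P) (hPA : P * A = A) {n : ℕ} {q x : ℝ} (hq : 0 < q) (hq1 : q ≤ 1)
    (hx : 0 < x)
    (h : ∀ v, P *ᵥ v = v → q * x ^ (n + 1) * (v ⬝ᵥ v) ≤ v ⬝ᵥ A ^ (n + 1) *ᵥ v) (v : Fin m → ℝ)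
    (hv : P *ᵥ v = v) : q * x ^ n * (v ⬝ᵥ v) ≤ v ⬝ᵥ A ^ n *ᵥ v := by
  have hAT : Aᵀ = A := by simpa using hA.isHermitian.eq
  set u : Fin m → Fin m → ℝ := fun i => (hA.isHermitian.eigenvectorBasis i).ofLp with hu
  set l := hA.isHermitian.eigenvalues with hl
  have hl0 : ∀ i, 0 ≤ l i := hA.eigenvalues_nonneg
  have hAu : ∀ i, A *ᵥ u i = l i • u i := hA.isHermitian.mulVec_eigenvectorBasis
  have hpow : ∀ k i, A ^ k *ᵥ u i = l i ^ k • u i := by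
    intro k i
    induction k with
    | zero => simp
    | succ k ih => rw [pow_succ, ← mulVec_mulVec, hAu, mulVec_smul, ih, smul_smul, pow_succ']
  have hAkT : ∀ k, (A ^ k)ᵀ = A ^ k := fun k => by rw [transpose_pow, hAT]
  have hexp : ∀ k, v ⬝ᵥ A ^ k *ᵥ v = ∑ i, l i ^ k * (u i ⬝ᵥ v) ^ 2 := by
    intro k
    have h1 := hA.isHermitian.eigenvectorBasis.sum_inner_mul_inner (WithLp.toLp 2 v)
      (WithLp.toLp 2 (A ^ k *ᵥ v))
    simp only [EuclideanSpace.inner_eq_star_dotProduct, star_trivial] at h1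
    rw [dotProduct_comm, ← h1]
    refine Finset.sum_congr rfl fun i _ => ?_
    have h2 : (A ^ k *ᵥ v) ⬝ᵥ u i = l i ^ k * (u i ⬝ᵥ v) := by
      rw [dotProduct_comm, dotProduct_mulVec, ← mulVec_transpose, hAkT, hpow, smul_dotProduct,
        smul_eq_mul]
    change (u i ⬝ᵥ v) * ((A ^ k *ᵥ v) ⬝ᵥ u i) = _
    rw [h2]; ring
  have h0 := hexp 0
  simp only [pow_zero, one_mulVec, one_mul] at h0
  rw [hexp, h0, Finset.mul_sum]
  refine Finset.sum_le_sum fun i _ => ?_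
  have huu : u i ⬝ᵥ u i = 1 := by
    rw [dotProduct_self_eq_norm_sq]
    have := hA.isHermitian.eigenvectorBasis.orthonormal.1 i
    change ‖hA.isHermitian.eigenvectorBasis i‖ ^ 2 = 1
    rw [this, one_pow]
  rcases (hl0 i).eq_or_lt with h0 | hpos
  · -- `P (u i) = 0`, since `A` kills `u i` and is bounded below on the range of `P`
    have h1 := h (P *ᵥ u i) (by rw [mulVec_mulVec, hPP])
    have hAP : A * P = A := by
      have := congrArg transpose hPA
      rwa [transpose_mul, hAT, hPT] at this
    have h2 : A ^ (n + 1) *ᵥ P *ᵥ u i = 0 := by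
      rw [mulVec_mulVec, pow_succ, mul_assoc, hAP, ← pow_succ, hpow, ← h0]; simp
    rw [h2, dotProduct_zero] at h1
    have h3 : P *ᵥ u i = 0 := by
      have h4 : P *ᵥ u i ⬝ᵥ P *ᵥ u i ≤ 0 := nonpos_of_mul_nonpos_right h1 (by positivity)
      rw [dotProduct_self_eq_norm_sq] at h4
      have h5 := pow_eq_zero_iff (two_ne_zero) |>.1 (le_antisymm h4 (sq_nonneg _))
      simpa using h5
    have h6 : u i ⬝ᵥ v = 0 := by
      rw [← hv, dotProduct_mulVec, ← mulVec_transpose, hPT, h3, zero_dotProduct]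
    simp [h6]
  · have hPu : P *ᵥ u i = u i := by
      have h1 : P *ᵥ A *ᵥ u i = A *ᵥ u i := by rw [mulVec_mulVec, hPA]
      rw [hAu, mulVec_smul] at h1
      exact smul_right_injective _ hpos.ne' h1
    have h1 := h (u i) hPu
    rw [hpow, dotProduct_smul, huu, smul_eq_mul, mul_one, mul_one] at h1
    refine mul_le_mul_of_nonneg_right ?_ (sq_nonneg _)
    rcases le_total x (l i) with hxl | hxl
    · calc q * x ^ n ≤ 1 * l i ^ n := by gcongr
        _ = l i ^ n := one_mul _
    · refine le_of_mul_le_mul_right ?_ hx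
      calc q * x ^ n * x = q * x ^ (n + 1) := by ring
        _ ≤ l i ^ n * l i := by rwa [← pow_succ]
        _ ≤ l i ^ n * x := by have := hl0 i; gcongr

end SpectralBounds

/-! ### Nearly balanced layers -/

section BalancedLayers

variable {m : ℕ}

/-- Layers that are nearly balanced have nearly equal norms, so a bound on the end-to-end matrix
bounds every layer. Here `f` and `y` stand for `‖Φ‖_F` and `‖Φ‖_F ^ (2 / N)`, where `N = n + 1`. -/
theorem opNorm_sq_pow_le_of_balanced {w : ℕ → Matrix (Fin m) (Fin m) ℝ} {n : ℕ} {f y δ : ℝ}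
    (hy : 0 < y) (hyf : y ^ (n + 1) = f ^ 2) (hδ : 0 ≤ δ)
    (hδy : 128 * (n + 1) ^ 3 * δ ≤ y)
    (hbal : ∀ j < n, ‖(w (j + 1))ᵀ * w (j + 1) - w j * (w j)ᵀ‖ ≤ δ)
    (hprod : ‖layerSegment w 0 (n + 1)‖ ≤ 2 * f) :
    ∀ j ≤ n, (‖w j‖ ^ 2) ^ (n + 1) ≤ 16 * y ^ (n + 1) := by
  obtain ⟨k, hk, hkmax⟩ := Finset.exists_max_image (Finset.range (n + 1)) (fun j => ‖w j‖ ^ 2)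
    ⟨0, by simp⟩
  set M := ‖w k‖ ^ 2 with hM
  have hmax : ∀ j ≤ n, ‖w j‖ ^ 2 ≤ M := fun j hj => hkmax j (Finset.mem_range.2 (by omega))
  have hkn : k ≤ n := by have := Finset.mem_range.1 hk; omega
  suffices hMy : M ^ (n + 1) ≤ 16 * y ^ (n + 1) from fun j hj =>
    (pow_le_pow_left₀ (sq_nonneg _) (hmax j hj) _).trans hMy
  by_contra! hcon
  have hyn : 0 < y ^ (n + 1) := by positivity
  have hM0 : 0 ≤ M := sq_nonneg _
  have hyM : y ≤ M := by
    by_contra! hlt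
    have := pow_le_pow_left₀ hM0 hlt.le (n + 1)
    linarith
  have hMpos : 0 < M := hy.trans_le hyM
  have hn1 : (0 : ℝ) < n + 1 := by positivity
  -- the norms of the layers differ by little from that of the last one
  have hdrop : ∀ i, k + i ≤ n → M - i * δ ≤ ‖w (k + i)‖ ^ 2 := by
    intro i
    induction i with
    | zero => simp [hM]
    | succ i ih =>
      intro hi
      have h1 := ih (by omega)
      have h2 := hbal (k + i) (by omega)
      have h3 := (norm_sub_norm_le _ _).trans ((norm_sub_rev _ _).trans_le h2)
      rw [opNorm_mul_transpose_self, opNorm_transpose_mul_self] at h3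
      push_cast
      rw [← add_assoc]
      linarith
  have hlast : M * (1 - 1 / (128 * (n + 1) ^ 2)) ≤ ‖w n‖ ^ 2 := by
    have h1 := hdrop (n - k) (by omega)
    rw [show k + (n - k) = n by omega] at h1
    have h2 : ((n - k : ℕ) : ℝ) ≤ n + 1 := by
      have : n - k ≤ n + 1 := by omega
      exact_mod_cast this
    have h3 : ((n - k : ℕ) : ℝ) * δ ≤ M * (1 / (128 * (n + 1) ^ 2)) := by
      rw [mul_one_div, le_div_iff₀ (by positivity)]
      calc ((n - k : ℕ) : ℝ) * δ * (128 * (n + 1) ^ 2) ≤ (n + 1) * δ * (128 * (n + 1) ^ 2) := by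
            gcongr
        _ = 128 * (n + 1) ^ 3 * δ := by ring
        _ ≤ M := hδy.trans hyM
    linarith
  have hlow : M ^ (n + 1) * (1 - 1 / 128) ≤ (‖w n‖ ^ 2) ^ (n + 1) := by
    have hsmall : 1 / (128 * ((n : ℝ) + 1) ^ 2) ≤ 1 / 128 := by
      apply one_div_le_one_div_of_le (by norm_num)
      nlinarith [(Nat.cast_nonneg n : (0 : ℝ) ≤ n)]
    have hb := one_add_mul_le_pow (a := -(1 / (128 * ((n : ℝ) + 1) ^ 2))) (by linarith) (n + 1)
    have hb' : 1 - 1 / 128 ≤ 1 + ((n + 1 : ℕ) : ℝ) * -(1 / (128 * ((n : ℝ) + 1) ^ 2)) := by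
      have : ((n + 1 : ℕ) : ℝ) * (1 / (128 * ((n : ℝ) + 1) ^ 2)) ≤ 1 / 128 := by
        push_cast
        rw [mul_one_div, div_le_div_iff₀ (by positivity) (by norm_num)]
        nlinarith [(Nat.cast_nonneg n : (0 : ℝ) ≤ n)]
      linarith
    calc M ^ (n + 1) * (1 - 1 / 128)
        ≤ M ^ (n + 1) * (1 + -(1 / (128 * ((n : ℝ) + 1) ^ 2))) ^ (n + 1) := by
          gcongr
          exact hb'.trans hb
      _ = (M * (1 - 1 / (128 * ((n : ℝ) + 1) ^ 2))) ^ (n + 1) := by rw [mul_pow]; ring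
      _ ≤ _ := by
          gcongr
          apply mul_nonneg hM0
          linarith
  have hup : (‖w n‖ ^ 2) ^ (n + 1) ≤ M ^ (n + 1) * (1 / 4) + M ^ (n + 1) * (1 / 128) := by
    have h1 := opNorm_gram_layerSegment_sub_pow_le (Nat.zero_le n) hδ hmax hbal
    have h2 := pow_opNorm_le_of_isHermitian (k := n + 1)
      (posSemidef_mul_transpose (w n)).isHermitian n.succ_ne_zero
    rw [opNorm_mul_transpose_self] at h2
    have h3 := norm_le_norm_add_norm_sub (layerSegment w 0 (n + 1) * (layerSegment w 0 (n + 1))ᵀ)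
      ((w n * (w n)ᵀ) ^ (n + 1))
    rw [opNorm_mul_transpose_self] at h3
    have h4 : ‖layerSegment w 0 (n + 1)‖ ^ 2 ≤ M ^ (n + 1) * (1 / 4) := by
      calc _ ≤ (2 * f) ^ 2 := by gcongr
        _ = 4 * y ^ (n + 1) := by rw [hyf]; ring
        _ ≤ _ := by linarith
    have h5 : ((n - 0 : ℕ) : ℝ) ^ 2 * δ * M ^ (n - 0) ≤ M ^ (n + 1) * (1 / 128) := by
      have : (n : ℝ) ^ 2 * δ ≤ M * (1 / 128) := by
        have : (n : ℝ) ^ 2 * δ ≤ (n + 1) ^ 3 * δ := by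
          gcongr
          nlinarith [(Nat.cast_nonneg n : (0 : ℝ) ≤ n), sq_nonneg (n : ℝ),
            pow_nonneg (Nat.cast_nonneg n : (0 : ℝ) ≤ n) 3]
        linarith
      calc _ = (n : ℝ) ^ 2 * δ * M ^ n := by simp
        _ ≤ M * (1 / 128) * M ^ n := by gcongr
        _ = _ := by ring
    simp only [Nat.sub_zero] at h1 h5
    linarith
  have : 0 < M ^ (n + 1) := by positivity
  linarith

theorem pow_le_sixteen_mul_pow {M y : ℝ} {n : ℕ} (hy : 0 < y) (hyM : y ≤ M)
    (hM : M ^ (n + 1) ≤ 16 * y ^ (n + 1)) : M ^ n ≤ 16 * y ^ n := by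
  have hM0 : 0 ≤ M := hy.le.trans hyM
  refine le_of_mul_le_mul_right ?_ hy
  calc M ^ n * y ≤ M ^ n * M := by gcongr
    _ ≤ 16 * y ^ (n + 1) := by rwa [← pow_succ]
    _ = 16 * y ^ n * y := by ring

/-- If the end-to-end matrix of nearly balanced layers is bounded below on the range of `P`, by
`c` with `c ^ 2 = x ^ N`, then so is the product of all layers but the first, by almost
`c ^ ((N - 1) / N)`: both are compared with powers of the Gram matrix of the last layer. -/
theorem le_frobNorm_transpose_layerSegment_mul {w : ℕ → Matrix (Fin m) (Fin m) ℝ}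
    {P : Matrix (Fin m) (Fin m) ℝ} {n : ℕ} {x y δ : ℝ} (hPT : Pᵀ = P) (hPP : P * P = P)
    (hPw : P * w n = w n) (hx : 0 < x) (hxy : x ≤ y) (hδ : 0 ≤ δ)
    (hδx : 128 * (n + 1) ^ 3 * y ^ n * δ ≤ x ^ (n + 1))
    (hbal : ∀ j < n, ‖(w (j + 1))ᵀ * w (j + 1) - w j * (w j)ᵀ‖ ≤ δ)
    (hw : ∀ j ≤ n, (‖w j‖ ^ 2) ^ (n + 1) ≤ 16 * y ^ (n + 1))
    (hlow : ∀ v, P *ᵥ v = v → x ^ (n + 1) * (v ⬝ᵥ v) ≤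
      (layerSegment w 0 (n + 1))ᵀ *ᵥ v ⬝ᵥ (layerSegment w 0 (n + 1))ᵀ *ᵥ v)
    {X : Matrix (Fin m) (Fin m) ℝ} (hX : P * X = X) :
    3 / 4 * x ^ n * frobNorm X ^ 2 ≤ frobNorm ((layerSegment w 1 (n + 1))ᵀ * X) ^ 2 := by
  have hy : 0 < y := hx.trans_le hxy
  obtain ⟨M, hyM, hMy, hMw⟩ : ∃ M, y ≤ M ∧ M ^ (n + 1) ≤ 16 * y ^ (n + 1) ∧
      ∀ j ≤ n, ‖w j‖ ^ 2 ≤ M := by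
    obtain ⟨k, hk, hkmax⟩ := Finset.exists_max_image (Finset.range (n + 1)) (fun j => ‖w j‖ ^ 2)
      ⟨0, by simp⟩
    have hkn : k ≤ n := by have := Finset.mem_range.1 hk; omega
    refine ⟨max y (‖w k‖ ^ 2), le_max_left _ _, ?_, fun j hj =>
      (hkmax j (Finset.mem_range.2 (by omega))).trans (le_max_right _ _)⟩
    rcases max_choice y (‖w k‖ ^ 2) with h | h <;> rw [h]
    · have : 0 < y ^ (n + 1) := by positivity
      linarith
    · exact hw k hkn
  have hMn := pow_le_sixteen_mul_pow hy hyM hMy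
  have hM0 : 0 < M := hy.trans_le hyM
  have hn : (0 : ℝ) ≤ n := Nat.cast_nonneg n
  have herr : (n : ℝ) ^ 2 * δ * M ^ n ≤ 1 / 8 * x ^ (n + 1) := by
    calc (n : ℝ) ^ 2 * δ * M ^ n ≤ (n + 1) ^ 3 * δ * (16 * y ^ n) := by
          gcongr
          nlinarith [sq_nonneg (n : ℝ), pow_nonneg hn 3]
      _ = 1 / 8 * (128 * (n + 1) ^ 3 * y ^ n * δ) := by ring
      _ ≤ _ := by gcongr
  have hgram : ∀ (a : ℕ) (v : Fin m → ℝ),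
      (layerSegment w a (n + 1))ᵀ *ᵥ v ⬝ᵥ (layerSegment w a (n + 1))ᵀ *ᵥ v
        = v ⬝ᵥ (layerSegment w a (n + 1) * (layerSegment w a (n + 1))ᵀ) *ᵥ v := by
    intro a v
    rw [← mulVec_mulVec, dotProduct_mulVec v, ← mulVec_transpose]
  have hPA : P * (w n * (w n)ᵀ) = w n * (w n)ᵀ := by rw [← mul_assoc, hPw]
  have hpow := mul_pow_le_dotProduct_pow_mulVec (n := n) (q := 7 / 8) (x := x)
    (posSemidef_mul_transpose (w n)) hPT hPP hPA (by norm_num) (by norm_num) hx (by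
      intro v hv
      have h1 := opNorm_gram_layerSegment_sub_pow_le (Nat.zero_le n) hδ hMw hbal
      have h2 := abs_dotProduct_mulVec_le (layerSegment w 0 (n + 1) * (layerSegment w 0 (n + 1))ᵀ
        - (w n * (w n)ᵀ) ^ (n + 1)) v
      have h3 := hlow v hv
      rw [hgram] at h3
      rw [sub_mulVec, dotProduct_sub] at h2
      have h4 := (abs_le.1 h2).2
      have hvv : 0 ≤ v ⬝ᵥ v := by rw [dotProduct_self_eq_norm_sq]; positivity
      simp only [Nat.sub_zero] at h1
      have h5 := mul_le_mul_of_nonneg_right (h1.trans herr) hvv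
      linarith)
  have hvec : ∀ v, P *ᵥ v = v → 3 / 4 * x ^ n * (v ⬝ᵥ v) ≤
      (layerSegment w 1 (n + 1))ᵀ *ᵥ v ⬝ᵥ (layerSegment w 1 (n + 1))ᵀ *ᵥ v := by
    intro v hv
    have hvv : 0 ≤ v ⬝ᵥ v := by rw [dotProduct_self_eq_norm_sq]; positivity
    rcases n.eq_zero_or_pos with rfl | hnpos
    · simp only [layerSegment_of_le w (show 0 + 1 ≤ 1 by omega)]
      simp
      linarith
    have h1 := opNorm_gram_layerSegment_sub_pow_le hnpos hδ hMw hbal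
    rw [show n - 1 + 1 = n by omega] at h1
    have h1' : ((n - 1 : ℕ) : ℝ) ^ 2 * δ * M ^ (n - 1) ≤ 1 / 8 * x ^ n := by
      refine le_of_mul_le_mul_right ?_ hM0
      calc ((n - 1 : ℕ) : ℝ) ^ 2 * δ * M ^ (n - 1) * M
          = ((n - 1 : ℕ) : ℝ) ^ 2 * δ * M ^ n := by
            obtain ⟨k, rfl⟩ : ∃ k, n = k + 1 := ⟨n - 1, by omega⟩
            simp only [Nat.add_sub_cancel]; ring
        _ ≤ (n : ℝ) ^ 2 * δ * M ^ n := by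
            gcongr
            exact Nat.sub_le n 1
        _ ≤ 1 / 8 * x ^ (n + 1) := herr
        _ = 1 / 8 * x ^ n * x := by ring
        _ ≤ 1 / 8 * x ^ n * M := by gcongr; exact hxy.trans hyM
    have h2 := abs_dotProduct_mulVec_le (layerSegment w 1 (n + 1) * (layerSegment w 1 (n + 1))ᵀ
        - (w n * (w n)ᵀ) ^ n) v
    rw [sub_mulVec, dotProduct_sub] at h2
    have h3 := (abs_le.1 h2).1
    have h4 := hpow v hv
    have h5 := mul_le_mul_of_nonneg_right (h1.trans h1') hvv
    rw [hgram]
    linarith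
  rw [frobNorm_sq_eq_sum_col, frobNorm_sq_eq_sum_col, Finset.mul_sum]
  refine Finset.sum_le_sum fun j _ => ?_
  rw [mul_col]
  exact hvec _ (by rw [← mul_col, hX])

/-- The statement of `le_frobNorm_transpose_layerSegment_mul` for the reversed network. -/
theorem le_frobNorm_mul_transpose_layerSegment {w : ℕ → Matrix (Fin m) (Fin m) ℝ}
    {P : Matrix (Fin m) (Fin m) ℝ} {n : ℕ} {x y δ : ℝ} (hPT : Pᵀ = P) (hPP : P * P = P)
    (hPw : w 0 * P = w 0) (hx : 0 < x) (hxy : x ≤ y) (hδ : 0 ≤ δ)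
    (hδx : 128 * (n + 1) ^ 3 * y ^ n * δ ≤ x ^ (n + 1))
    (hbal : ∀ j < n, ‖(w (j + 1))ᵀ * w (j + 1) - w j * (w j)ᵀ‖ ≤ δ)
    (hw : ∀ j ≤ n, (‖w j‖ ^ 2) ^ (n + 1) ≤ 16 * y ^ (n + 1))
    (hlow : ∀ v, P *ᵥ v = v → x ^ (n + 1) * (v ⬝ᵥ v) ≤
      layerSegment w 0 (n + 1) *ᵥ v ⬝ᵥ layerSegment w 0 (n + 1) *ᵥ v)
    {X : Matrix (Fin m) (Fin m) ℝ} (hX : X * P = X) :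
    3 / 4 * x ^ n * frobNorm X ^ 2 ≤ frobNorm (X * (layerSegment w 0 n)ᵀ) ^ 2 := by
  have h := le_frobNorm_transpose_layerSegment_mul (w := fun j => (w (n - j))ᵀ) (X := Xᵀ)
    (P := P) (n := n) (δ := δ) hPT hPP
    (by simpa [hPT] using congrArg transpose hPw) hx hxy hδ hδx
    (by
      intro j hj
      have h1 := hbal (n - (j + 1)) (by omega)
      rw [show n - (j + 1) + 1 = n - j by omega, norm_sub_rev] at h1
      simpa using h1)
    (by
      intro j _
      rw [opNorm_transpose]
      exact hw _ (by omega))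
    (by
      intro v hv
      rw [layerSegment_reverse w n (Nat.zero_le _) le_rfl]
      simpa using hlow v hv)
    (by simpa [hPT] using congrArg transpose hX)
  rw [layerSegment_reverse w n (by omega) le_rfl, frobNorm_transpose, transpose_transpose] at h
  rw [← frobNorm_transpose (X * (layerSegment w 0 n)ᵀ), transpose_mul, transpose_transpose]
  simpa using h

end BalancedLayers

/-! ### One step of gradient descent -/

section GradientStep

variable {m : ℕ}

/-- The gradient of `½ ‖w n * ⋯ * w 0 - Φ‖_F²` with respect to `w j`, where `E` stands for the
residual `w n * ⋯ * w 0 - Φ`. -/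
noncomputable def layerGrad (w : ℕ → Matrix (Fin m) (Fin m) ℝ) (n : ℕ)
    (E : Matrix (Fin m) (Fin m) ℝ) (j : ℕ) : Matrix (Fin m) (Fin m) ℝ :=
  (layerSegment w (j + 1) (n + 1))ᵀ * E * (layerSegment w 0 j)ᵀ

/-- The gradients of consecutive layers satisfy `w (j + 1)ᵀ G (j + 1) = G j (w j)ᵀ`; this is what
makes balancedness a conserved quantity up to second order. -/
theorem transpose_mul_layerGrad_succ (w : ℕ → Matrix (Fin m) (Fin m) ℝ) {n j : ℕ} (hj : j < n)
    (E : Matrix (Fin m) (Fin m) ℝ) :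
    (w (j + 1))ᵀ * layerGrad w n E (j + 1) = layerGrad w n E j * (w j)ᵀ := by
  unfold layerGrad
  rw [layerSegment_succ_left w (show j + 1 < n + 1 by omega),
    layerSegment_succ_right w j.zero_le]
  simp only [transpose_mul, mul_assoc]

theorem frobNorm_balance_step_le {w w' : ℕ → Matrix (Fin m) (Fin m) ℝ} {n j : ℕ} (hj : j < n)
    {η : ℝ} (E : Matrix (Fin m) (Fin m) ℝ) (hw' : ∀ j ≤ n, w' j = w j - η • layerGrad w n E j) :
    frobNorm ((w' (j + 1))ᵀ * w' (j + 1) - w' j * (w' j)ᵀ)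
      ≤ frobNorm ((w (j + 1))ᵀ * w (j + 1) - w j * (w j)ᵀ)
        + η ^ 2 * ∑ i ∈ Finset.range (n + 1), frobNorm (layerGrad w n E i) ^ 2 := by
  set G := layerGrad w n E with hG
  have h1 : (w (j + 1))ᵀ * G (j + 1) = G j * (w j)ᵀ := transpose_mul_layerGrad_succ w hj E
  have h2 : (G (j + 1))ᵀ * w (j + 1) = w j * (G j)ᵀ := by
    simpa [transpose_mul] using congrArg transpose h1
  have e : (w' (j + 1))ᵀ * w' (j + 1) - w' j * (w' j)ᵀ
      = ((w (j + 1))ᵀ * w (j + 1) - w j * (w j)ᵀ)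
        + η ^ 2 • ((G (j + 1))ᵀ * G (j + 1) - G j * (G j)ᵀ) := by
    rw [hw' (j + 1) (by omega), hw' j (by omega)]
    simp only [transpose_sub, transpose_smul, sub_mul, mul_sub, smul_mul_assoc, mul_smul_comm, h1,
      h2, smul_sub, smul_smul, sq]
    abel
  rw [e]
  refine (frobNorm_add_le _ _).trans (add_le_add le_rfl ?_)
  rw [frobNorm_smul, abs_of_nonneg (sq_nonneg η)]
  refine mul_le_mul_of_nonneg_left ?_ (sq_nonneg η)
  calc _ ≤ frobNorm (G (j + 1)) ^ 2 + frobNorm (G j) ^ 2 := by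
        refine (frobNorm_sub_le _ _).trans (add_le_add ?_ ?_)
        · simpa [frobNorm_transpose, sq] using frobNorm_mul_le (G (j + 1))ᵀ (G (j + 1))
        · simpa [frobNorm_transpose, sq] using frobNorm_mul_le (G j) (G j)ᵀ
    _ = ∑ i ∈ {j + 1, j}, frobNorm (G i) ^ 2 := by
        rw [Finset.sum_pair (by omega)]
    _ ≤ _ := by
        refine Finset.sum_le_sum_of_subset_of_nonneg ?_ fun _ _ _ => sq_nonneg _
        intro i hi
        simp only [Finset.mem_insert, Finset.mem_singleton] at hi
        rw [Finset.mem_range]; omega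

/-- The first-order change of the residual pairs with the residual to the squared gradient. -/
theorem trace_transpose_mul_layerGrad (w : ℕ → Matrix (Fin m) (Fin m) ℝ) (n j : ℕ)
    (E : Matrix (Fin m) (Fin m) ℝ) :
    (Eᵀ * (layerSegment w (j + 1) (n + 1) * layerGrad w n E j * layerSegment w 0 j)).trace
      = frobNorm (layerGrad w n E j) ^ 2 := by
  rw [frobNorm_sq]
  have e : (layerGrad w n E j)ᵀ = layerSegment w 0 j * Eᵀ * layerSegment w (j + 1) (n + 1) := by
    simp [layerGrad, transpose_mul, mul_assoc]
  rw [e, mul_assoc (layerSegment w 0 j), mul_assoc (layerSegment w 0 j),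
    trace_mul_comm (layerSegment w 0 j)]
  simp only [mul_assoc]

theorem mul_opNorm_layerSegment_sub_le {w w' : ℕ → Matrix (Fin m) (Fin m) ℝ} {k : ℕ} {θ : ℝ}
    (hθ : 0 ≤ θ) (hw : ∀ j < k, ‖w j‖ ≤ θ) (hw' : ∀ j < k, ‖w' j‖ ≤ θ) :
    θ * ‖layerSegment w' 0 k - layerSegment w 0 k‖
      ≤ θ ^ k * ∑ j ∈ Finset.range k, ‖w' j - w j‖ := by
  rw [layerSegment_sub_layerSegment]
  refine (mul_le_mul_of_nonneg_left (norm_sum_le _ _) hθ).trans ?_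
  rw [Finset.mul_sum, Finset.mul_sum]
  refine Finset.sum_le_sum fun j hj => ?_
  have hjk := Finset.mem_range.1 hj
  have h1 := opNorm_layerSegment_le (w := w) (a := j + 1) (b := k) hθ fun i _ h => hw i h
  have h2 := opNorm_layerSegment_le (w := w') (a := 0) (b := j) hθ fun i _ h => hw' i (by omega)
  calc _ ≤ θ * (‖layerSegment w (j + 1) k‖ * ‖w' j - w j‖ * ‖layerSegment w' 0 j‖) := by
        gcongr
        exact (norm_mul_le _ _).trans (by gcongr; exact norm_mul_le _ _)
    _ ≤ θ * (θ ^ (k - (j + 1)) * ‖w' j - w j‖ * θ ^ (j - 0)) := by gcongr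
    _ = θ ^ k * ‖w' j - w j‖ := by
        obtain ⟨i, rfl⟩ : ∃ i, k = i + j + 1 := ⟨k - (j + 1), by omega⟩
        rw [show i + j + 1 - (j + 1) = i by omega, Nat.sub_zero]; ring

theorem mul_frobNorm_layerSegment_sub_le {w w' : ℕ → Matrix (Fin m) (Fin m) ℝ} {k : ℕ} {θ : ℝ}
    (hθ : 0 ≤ θ) (hw : ∀ j < k, ‖w j‖ ≤ θ) (hw' : ∀ j < k, ‖w' j‖ ≤ θ) :
    θ * frobNorm (layerSegment w' 0 k - layerSegment w 0 k)
      ≤ θ ^ k * ∑ j ∈ Finset.range k, frobNorm (w' j - w j) := by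
  rw [layerSegment_sub_layerSegment]
  refine (mul_le_mul_of_nonneg_left (frobNorm_sum_le _ _) hθ).trans ?_
  rw [Finset.mul_sum, Finset.mul_sum]
  refine Finset.sum_le_sum fun j hj => ?_
  have hjk := Finset.mem_range.1 hj
  have h1 := opNorm_layerSegment_le (w := w) (a := j + 1) (b := k) hθ fun i _ h => hw i h
  have h2 := opNorm_layerSegment_le (w := w') (a := 0) (b := j) hθ fun i _ h => hw' i (by omega)
  have h3 := frobNorm_nonneg (w' j - w j)
  calc _ ≤ θ * (‖layerSegment w (j + 1) k‖ * frobNorm (w' j - w j) * ‖layerSegment w' 0 j‖) := by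
        gcongr
        exact (frobNorm_mul_le_mul_opNorm _ _).trans
          (by gcongr; exact frobNorm_mul_le_opNorm_mul _ _)
    _ ≤ θ * (θ ^ (k - (j + 1)) * frobNorm (w' j - w j) * θ ^ (j - 0)) := by gcongr
    _ = θ ^ k * frobNorm (w' j - w j) := by
        obtain ⟨i, rfl⟩ : ∃ i, k = i + j + 1 := ⟨k - (j + 1), by omega⟩
        rw [show i + j + 1 - (j + 1) = i by omega, Nat.sub_zero]; ring

/-- The product of perturbed layers agrees with its first-order expansion up to an error that is
quadratic in the perturbation. -/
theorem sq_mul_frobNorm_layerSegment_remainder_le {w w' : ℕ → Matrix (Fin m) (Fin m) ℝ} {k : ℕ}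
    {θ : ℝ} (hθ : 0 ≤ θ) (hw : ∀ j < k, ‖w j‖ ≤ θ) (hw' : ∀ j < k, ‖w' j‖ ≤ θ) :
    θ ^ 2 * frobNorm (layerSegment w' 0 k - layerSegment w 0 k
        - ∑ j ∈ Finset.range k, layerSegment w (j + 1) k * (w' j - w j) * layerSegment w 0 j)
      ≤ θ ^ k * (∑ j ∈ Finset.range k, frobNorm (w' j - w j)) ^ 2 := by
  have e : layerSegment w' 0 k - layerSegment w 0 k
        - ∑ j ∈ Finset.range k, layerSegment w (j + 1) k * (w' j - w j) * layerSegment w 0 j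
      = ∑ j ∈ Finset.range k, layerSegment w (j + 1) k * (w' j - w j)
          * (layerSegment w' 0 j - layerSegment w 0 j) := by
    rw [layerSegment_sub_layerSegment, ← Finset.sum_sub_distrib]
    exact Finset.sum_congr rfl fun j _ => (mul_sub _ _ _).symm
  rw [e]
  refine (mul_le_mul_of_nonneg_left (frobNorm_sum_le _ _) (sq_nonneg θ)).trans ?_
  rw [sq (∑ j ∈ Finset.range k, frobNorm (w' j - w j)), ← mul_assoc, Finset.mul_sum,
    mul_right_comm, Finset.mul_sum]
  refine Finset.sum_le_sum fun j hj => ?_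
  have hjk := Finset.mem_range.1 hj
  have h1 := opNorm_layerSegment_le (w := w) (a := j + 1) (b := k) hθ fun i _ h => hw i h
  have h2 : θ * ‖layerSegment w' 0 j - layerSegment w 0 j‖
      ≤ θ ^ j * ∑ i ∈ Finset.range k, frobNorm (w' i - w i) := by
    refine (mul_opNorm_layerSegment_sub_le hθ (fun i hi => hw i (by omega))
      fun i hi => hw' i (by omega)).trans ?_
    gcongr
    refine (Finset.sum_le_sum fun i _ => opNorm_le_frobNorm _).trans
      (Finset.sum_le_sum_of_subset_of_nonneg ?_ fun _ _ _ => frobNorm_nonneg _)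
    exact Finset.range_subset_range.2 hjk.le
  have h3 := frobNorm_nonneg (w' j - w j)
  calc _ ≤ θ ^ 2 * (‖layerSegment w (j + 1) k‖ * frobNorm (w' j - w j)
          * ‖layerSegment w' 0 j - layerSegment w 0 j‖) := by
        gcongr
        exact (frobNorm_mul_le_mul_opNorm _ _).trans
          (by gcongr; exact frobNorm_mul_le_opNorm_mul _ _)
    _ = θ * ‖layerSegment w (j + 1) k‖ * frobNorm (w' j - w j)
          * (θ * ‖layerSegment w' 0 j - layerSegment w 0 j‖) := by ring
    _ ≤ θ * θ ^ (k - (j + 1)) * frobNorm (w' j - w j)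
          * (θ ^ j * ∑ i ∈ Finset.range k, frobNorm (w' i - w i)) := by gcongr
    _ = _ := by
        obtain ⟨i, rfl⟩ : ∃ i, k = i + j + 1 := ⟨k - (j + 1), by omega⟩
        rw [show i + j + 1 - (j + 1) = i by omega]; ring

theorem one_add_one_div_pow_le_three (n : ℕ) : (1 + 1 / ((n : ℝ) + 1)) ^ (n + 1) ≤ 3 := by
  have h : 1 + 1 / ((n : ℝ) + 1) ≤ Real.exp (1 / (n + 1)) := by
    linarith [Real.add_one_le_exp (1 / ((n : ℝ) + 1))]
  calc _ ≤ Real.exp (1 / (n + 1)) ^ (n + 1) := by gcongr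
    _ = Real.exp 1 := by
        rw [← Real.exp_nat_mul]; congr 1; push_cast; field_simp
    _ ≤ 3 := by linarith [Real.exp_one_lt_d9]

theorem frobNorm_step_eq {w w' G : ℕ → Matrix (Fin m) (Fin m) ℝ} {n : ℕ} {η : ℝ} (hη : 0 < η)
    (hw' : ∀ j ≤ n, w' j = w j - η • G j) (j : ℕ) (hj : j ≤ n) :
    frobNorm (w' j - w j) = η * frobNorm (G j) := by
  rw [hw' j hj, show w j - η • G j - w j = -(η • G j) by abel, frobNorm_neg, frobNorm_smul,
    abs_of_pos hη]

/-- The layers before and after a small gradient step have a common norm bound `θ` that is of order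
`‖Φ‖_F ^ (1 / N)`. Here `f` and `y` stand for `‖Φ‖_F` and `‖Φ‖_F ^ (2 / N)`, where `N = n + 1`. -/
theorem exists_opNorm_bound_before_after_step {w w' : ℕ → Matrix (Fin m) (Fin m) ℝ} {n : ℕ}
    {f y η : ℝ} {E : Matrix (Fin m) (Fin m) ℝ} (hy : 0 < y) (hf : 0 ≤ f)
    (hyf : y ^ (n + 1) = f ^ 2) (hη : 0 < η) (hηN : 6144 * (n + 1) * y ^ n * η ≤ 1)
    (hw : ∀ j ≤ n, (‖w j‖ ^ 2) ^ (n + 1) ≤ 16 * y ^ (n + 1)) (hE : frobNorm E ≤ f)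
    (hw' : ∀ j ≤ n, w' j = w j - η • layerGrad w n E j) :
    ∃ θ, 0 ≤ θ ∧ y ≤ θ ^ 2 ∧ θ ^ (n + 1) ≤ 12 * f ∧ (∀ j < n + 1, ‖w j‖ ≤ θ) ∧
      ∀ j < n + 1, ‖w' j‖ ≤ θ := by
  set G := layerGrad w n E with hG
  have hn1 : (0 : ℝ) < n + 1 := by positivity
  -- the common bound `s` of the layers, with `s ^ N = 4 ‖Φ‖_F`
  obtain ⟨s, hs0, hsN⟩ : ∃ s : ℝ, 0 ≤ s ∧ s ^ (n + 1) = 4 * f := by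
    refine ⟨(4 * f) ^ (((n + 1 : ℕ) : ℝ)⁻¹), by positivity, ?_⟩
    exact Real.rpow_inv_natCast_pow (by positivity) n.succ_ne_zero
  have hs2 : (s ^ 2) ^ (n + 1) = 16 * y ^ (n + 1) := by
    rw [← pow_mul, mul_comm, pow_mul, hsN, hyf]; ring
  have hys : y ≤ s ^ 2 := by
    refine le_of_pow_le_pow_left₀ (n := n + 1) n.succ_ne_zero (sq_nonneg s) ?_
    rw [hs2]
    linarith [pow_pos hy (n + 1)]
  have hspos : 0 < s := by
    rcases hs0.eq_or_lt with h | h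
    · rw [← h] at hys; norm_num at hys; linarith
    · exact h
  have hws : ∀ j ≤ n, ‖w j‖ ≤ s := fun j hj => by
    refine le_of_sq_le_sq (le_of_pow_le_pow_left₀ (n := n + 1) n.succ_ne_zero (sq_nonneg s) ?_) hs0
    rw [hs2]
    exact hw j hj
  have hE0 := frobNorm_nonneg E
  have hG_le : ∀ j ≤ n, η * frobNorm (G j) ≤ s / (n + 1) := by
    intro j hj
    have h1 := opNorm_layerSegment_le (w := w) (a := j + 1) (b := n + 1) hs0
      fun i _ h => hws i (by omega)
    have h2 := opNorm_layerSegment_le (w := w) (a := 0) (b := j) hs0 fun i _ h => hws i (by omega)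
    have h3 : frobNorm (G j) ≤ s ^ n * f := by
      calc frobNorm (G j) ≤ ‖(layerSegment w (j + 1) (n + 1))ᵀ‖ * frobNorm E
            * ‖(layerSegment w 0 j)ᵀ‖ :=
            (frobNorm_mul_le_mul_opNorm _ _).trans
              (by gcongr; exact frobNorm_mul_le_opNorm_mul _ _)
        _ ≤ s ^ (n + 1 - (j + 1)) * f * s ^ (j - 0) := by
            rw [opNorm_transpose, opNorm_transpose]; gcongr
        _ = s ^ n * f := by
            obtain ⟨i, rfl⟩ : ∃ i, n = i + j := ⟨n - j, by omega⟩
            rw [show i + j + 1 - (j + 1) = i by omega, Nat.sub_zero]; ring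
    rw [le_div_iff₀ hn1]
    refine le_of_mul_le_mul_right ?_ hspos
    calc η * frobNorm (G j) * (n + 1) * s ≤ η * (s ^ n * f) * (n + 1) * s := by gcongr
      _ = η * (n + 1) * f * s ^ (n + 1) := by ring
      _ = 4 * (η * (n + 1)) * y ^ (n + 1) := by rw [hsN, hyf]; ring
      _ = 4 / 6144 * (6144 * (n + 1) * y ^ n * η) * y := by ring
      _ ≤ 4 / 6144 * 1 * y := by gcongr
      _ ≤ s * s := by nlinarith
  set θ := s * (1 + 1 / (n + 1)) with hθ
  have hsθ : s ≤ θ := by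
    have : 0 ≤ s * (1 / ((n : ℝ) + 1)) := by positivity
    rw [hθ]; linarith
  have hθ0 : 0 ≤ θ := hs0.trans hsθ
  have hyθ : y ≤ θ ^ 2 := hys.trans (by gcongr)
  have hθN : θ ^ (n + 1) ≤ 12 * f := by
    rw [hθ, mul_pow, hsN]
    have := mul_le_mul_of_nonneg_left (one_add_one_div_pow_le_three n)
      (show 0 ≤ 4 * f by positivity)
    linarith
  refine ⟨θ, hθ0, hyθ, hθN, fun j hj => (hws j (by omega)).trans hsθ, fun j hj => ?_⟩
  have h1 : ‖w' j‖ ≤ ‖w j‖ + ‖w' j - w j‖ := by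
    have := norm_add_le (w j) (w' j - w j)
    rwa [add_sub_cancel] at this
  have h2 := (opNorm_le_frobNorm (w' j - w j)).trans_eq (frobNorm_step_eq hη hw' j (by omega))
  have h3 := hG_le j (by omega)
  have h4 := hws j (by omega)
  have h5 : θ = s + s / (n + 1) := by rw [hθ]; ring
  linarith

/-- The pairing of the residual (of norm `e`) with the second-order remainder (of norm `r`) is a small
multiple of `η S`. Here `t` and `q` stand for `θ ^ N` and the squared sum of the perturbations. -/
theorem residual_mul_remainder_le {n : ℕ} {y f η S e r θ t q : ℝ} (hy : 0 < y)
    (hyf : y ^ (n + 1) = f ^ 2) (hηN : 6144 * (n + 1) * y ^ n * η ≤ 1) (hη : 0 ≤ η) (hS : 0 ≤ S)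
    (hf : 0 ≤ f) (he : 0 ≤ e) (hef : e ≤ f) (hr : 0 ≤ r) (hyθ : y ≤ θ ^ 2)
    (htf : t ≤ 12 * f) (hq : 0 ≤ q) (hrq : θ ^ 2 * r ≤ t * q)
    (hqS : q ≤ η ^ 2 * ((n + 1) * S)) : e * r ≤ 12 / 6144 * (η * S) := by
  refine le_of_mul_le_mul_left ?_ hy
  calc y * (e * r) ≤ θ ^ 2 * (f * r) := by gcongr
    _ = f * (θ ^ 2 * r) := by ring
    _ ≤ f * (t * q) := by gcongr
    _ ≤ f * (12 * f * (η ^ 2 * ((n + 1) * S))) := by gcongr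
    _ = 12 * (η ^ 2 * ((n + 1) * S)) * f ^ 2 := by ring
    _ = 12 * (η ^ 2 * ((n + 1) * S)) * y ^ (n + 1) := by rw [hyf]
    _ = 12 / 6144 * (6144 * (n + 1) * y ^ n * η) * (y * (η * S)) := by ring
    _ ≤ 12 / 6144 * 1 * (y * (η * S)) := by gcongr
    _ = _ := by ring

/-- The squared change `d ^ 2` of the end-to-end matrix is a small multiple of `η S`. Here `t` and `q`
stand for `θ ^ N` and the sum of the perturbations of the layers. -/
theorem change_sq_le {n : ℕ} {y f η S d θ t q : ℝ} (hy : 0 < y)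
    (hyf : y ^ (n + 1) = f ^ 2) (hηN : 6144 * (n + 1) * y ^ n * η ≤ 1) (hη : 0 ≤ η) (hS : 0 ≤ S)
    (hd : 0 ≤ d) (hyθ : y ≤ θ ^ 2) (hθ : 0 ≤ θ) (ht : 0 ≤ t) (htf : t ≤ 12 * f)
    (hdq : θ * d ≤ t * q) (hqS : q ^ 2 ≤ η ^ 2 * ((n + 1) * S)) :
    d ^ 2 ≤ 144 / 6144 * (η * S) := by
  refine le_of_mul_le_mul_left ?_ hy
  calc y * d ^ 2 ≤ θ ^ 2 * d ^ 2 := by gcongr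
    _ = (θ * d) ^ 2 := by ring
    _ ≤ (t * q) ^ 2 := by gcongr
    _ = t ^ 2 * q ^ 2 := by ring
    _ ≤ (12 * f) ^ 2 * (η ^ 2 * ((n + 1) * S)) := by gcongr
    _ = 144 * (η ^ 2 * ((n + 1) * S)) * f ^ 2 := by ring
    _ = 144 * (η ^ 2 * ((n + 1) * S)) * y ^ (n + 1) := by rw [hyf]
    _ = 144 / 6144 * (6144 * (n + 1) * y ^ n * η) * (y * (η * S)) := by ring
    _ ≤ 144 / 6144 * 1 * (y * (η * S)) := by gcongr
    _ = _ := by ring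

/-- One step of gradient descent with a small learning rate decreases the squared residual by at
least `3/2 η` times the squared norm of the gradient. Here `f` and `y` stand for `‖Φ‖_F` and
`‖Φ‖_F ^ (2 / N)`, where `N = n + 1`. -/
theorem frobNorm_residual_step_sq_le {w w' : ℕ → Matrix (Fin m) (Fin m) ℝ} {n : ℕ}
    {f y η : ℝ} {Φ : Matrix (Fin m) (Fin m) ℝ} (hy : 0 < y) (hf : 0 ≤ f)
    (hyf : y ^ (n + 1) = f ^ 2) (hη : 0 < η) (hηy : 6144 * (n + 1) ^ 3 * y ^ n * η ≤ 1)
    (hw : ∀ j ≤ n, (‖w j‖ ^ 2) ^ (n + 1) ≤ 16 * y ^ (n + 1))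
    (hE : frobNorm (layerSegment w 0 (n + 1) - Φ) ≤ f)
    (hw' : ∀ j ≤ n, w' j = w j - η • layerGrad w n (layerSegment w 0 (n + 1) - Φ) j) :
    frobNorm (layerSegment w' 0 (n + 1) - Φ) ^ 2
      ≤ frobNorm (layerSegment w 0 (n + 1) - Φ) ^ 2
        - 3 / 2 * η * ∑ j ∈ Finset.range (n + 1),
          frobNorm (layerGrad w n (layerSegment w 0 (n + 1) - Φ) j) ^ 2 := by
  set E := layerSegment w 0 (n + 1) - Φ with hEdef
  set G := layerGrad w n E with hG
  set S := ∑ j ∈ Finset.range (n + 1), frobNorm (G j) ^ 2 with hS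
  have hS0 : 0 ≤ S := Finset.sum_nonneg fun _ _ => sq_nonneg _
  have hE0 := frobNorm_nonneg E
  have hηN : 6144 * (n + 1) * y ^ n * η ≤ 1 := by
    refine le_trans ?_ hηy
    gcongr
    exact le_self_pow₀ (by linarith) (by norm_num)
  obtain ⟨θ, hθ0, hyθ, hθN, hwθ, hw'θ⟩ :=
    exists_opNorm_bound_before_after_step hy hf hyf hη hηN hw hE hw'
  have hdiff := frobNorm_step_eq hη hw'
  have hsum : ∑ j ∈ Finset.range (n + 1), frobNorm (w' j - w j)
      = η * ∑ j ∈ Finset.range (n + 1), frobNorm (G j) := by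
    rw [Finset.mul_sum]
    exact Finset.sum_congr rfl fun j hj => hdiff j (by have := Finset.mem_range.1 hj; omega)
  have hsumsq : (∑ j ∈ Finset.range (n + 1), frobNorm (w' j - w j)) ^ 2
      ≤ η ^ 2 * ((n + 1) * S) := by
    rw [hsum, mul_pow]
    have := sq_sum_le_card_mul_sum_sq (s := Finset.range (n + 1)) (f := fun j => frobNorm (G j))
    rw [Finset.card_range] at this
    push_cast at this
    gcongr
  set Δ := layerSegment w' 0 (n + 1) - layerSegment w 0 (n + 1) with hΔ
  set R := Δ - ∑ j ∈ Finset.range (n + 1),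
    layerSegment w (j + 1) (n + 1) * (w' j - w j) * layerSegment w 0 j with hR
  have hRle := sq_mul_frobNorm_layerSegment_remainder_le hθ0 hwθ hw'θ
  have hΔle := mul_frobNorm_layerSegment_sub_le hθ0 hwθ hw'θ
  rw [← hΔ, ← hR] at hRle
  rw [← hΔ] at hΔle
  have hR0 := frobNorm_nonneg R
  have hΔ0 := frobNorm_nonneg Δ
  have hER := residual_mul_remainder_le hy hyf hηN hη.le hS0 hf hE0 hE hR0 hyθ hθN
    (sq_nonneg _) hRle hsumsq
  have hΔΔ := change_sq_le hy hyf hηN hη.le hS0 hΔ0 hyθ hθ0 (by positivity) hθN hΔle hsumsq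
  have hfirst : (Eᵀ * Δ).trace = -(η * S) + (Eᵀ * R).trace := by
    have e : ∑ j ∈ Finset.range (n + 1),
          layerSegment w (j + 1) (n + 1) * (w' j - w j) * layerSegment w 0 j
        = -(η • ∑ j ∈ Finset.range (n + 1),
          layerSegment w (j + 1) (n + 1) * G j * layerSegment w 0 j) := by
      rw [Finset.smul_sum, ← Finset.sum_neg_distrib]
      refine Finset.sum_congr rfl fun j hj => ?_
      rw [hw' j (by have := Finset.mem_range.1 hj; omega)]
      simp
    have e' : Δ = -(η • ∑ j ∈ Finset.range (n + 1),
        layerSegment w (j + 1) (n + 1) * G j * layerSegment w 0 j) + R := by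
      rw [hR, e]; abel
    rw [congrArg (fun X => (Eᵀ * X).trace) e', mul_add, trace_add, mul_neg, trace_neg,
      mul_smul_comm, trace_smul, Finset.mul_sum, trace_sum, hS, smul_eq_mul]
    congr 3
    exact Finset.sum_congr rfl fun j _ => trace_transpose_mul_layerGrad w n j E
  have hE' : layerSegment w' 0 (n + 1) - Φ = E + Δ := by rw [hEdef, hΔ]; abel
  rw [hE', frobNorm_add_sq, hfirst]
  have := trace_transpose_mul_le E R
  have hηS : 0 ≤ η * S := mul_nonneg hη.le hS0
  linarith

end GradientStep

/-! ### Convergence for layers of equal width -/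

section Convergence

variable {m : ℕ}

theorem learningRate_mul_pow_le_one {n : ℕ} {x y η : ℝ} (hx : 0 ≤ x) (hxy : x ≤ y) (hη : 0 ≤ η)
    (hηy : 6144 * ((n : ℝ) + 1) ^ 3 * y ^ n * η ≤ 1) : η * x ^ n ≤ 1 := by
  have hN : (1 : ℝ) ≤ 6144 * ((n : ℝ) + 1) ^ 3 := by
    have : (1 : ℝ) ≤ ((n : ℝ) + 1) ^ 3 :=
      one_le_pow₀ (by linarith [(Nat.cast_nonneg n : (0 : ℝ) ≤ n)])
    linarith
  have hy : 0 ≤ y := hx.trans hxy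
  calc η * x ^ n ≤ η * y ^ n := by gcongr
    _ = 1 * (y ^ n * η) := by ring
    _ ≤ 6144 * ((n : ℝ) + 1) ^ 3 * (y ^ n * η) := by gcongr
    _ = 6144 * ((n : ℝ) + 1) ^ 3 * y ^ n * η := by ring
    _ ≤ 1 := hηy

/-- Linear convergence of gradient descent on layers of equal width, as long as the gradient
dominates the residual along the trajectory. The deviation from balancedness grows by at most `2/3`
of `η` times the decrease of the squared residual, hence stays below `2 δ`. -/
theorem frobNorm_residual_sq_le_pow_mul {w : ℕ → ℕ → Matrix (Fin m) (Fin m) ℝ} {n : ℕ}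
    {f x y η δ : ℝ} {Φ : Matrix (Fin m) (Fin m) ℝ} (hx : 0 < x) (hxy : x ≤ y) (hf : 0 ≤ f)
    (hyf : y ^ (n + 1) = f ^ 2) (hη : 0 < η) (hηy : 6144 * (n + 1) ^ 3 * y ^ n * η ≤ 1)
    (hδ : 0 ≤ δ) (hδy : 256 * (n + 1) ^ 3 * δ ≤ y) (hηδ : η * f ^ 2 ≤ δ) (hΦ : frobNorm Φ ≤ f)
    (hE0 : frobNorm (layerSegment (w 0) 0 (n + 1) - Φ) ≤ f)
    (hbal : ∀ j < n, frobNorm ((w 0 (j + 1))ᵀ * w 0 (j + 1) - w 0 j * (w 0 j)ᵀ) ≤ δ)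
    (hstep : ∀ t, ∀ j ≤ n,
      w (t + 1) j = w t j - η • layerGrad (w t) n (layerSegment (w t) 0 (n + 1) - Φ) j)
    (hgrad : ∀ t, frobNorm (layerSegment (w t) 0 (n + 1) - Φ)
        ≤ frobNorm (layerSegment (w 0) 0 (n + 1) - Φ) →
      (∀ j < n, ‖(w t (j + 1))ᵀ * w t (j + 1) - w t j * (w t j)ᵀ‖ ≤ 2 * δ) →
      (∀ j ≤ n, (‖w t j‖ ^ 2) ^ (n + 1) ≤ 16 * y ^ (n + 1)) →
      3 / 4 * x ^ n * frobNorm (layerSegment (w t) 0 (n + 1) - Φ) ^ 2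
        ≤ ∑ j ∈ Finset.range (n + 1),
          frobNorm (layerGrad (w t) n (layerSegment (w t) 0 (n + 1) - Φ) j) ^ 2) (T : ℕ) :
    frobNorm (layerSegment (w T) 0 (n + 1) - Φ) ^ 2
      ≤ (1 - η * x ^ n) ^ T * frobNorm (layerSegment (w 0) 0 (n + 1) - Φ) ^ 2 := by
  have hy : 0 < y := hx.trans_le hxy
  set r : ℕ → ℝ := fun t => frobNorm (layerSegment (w t) 0 (n + 1) - Φ) with hr
  have hr0 : ∀ t, 0 ≤ r t := fun t => frobNorm_nonneg _
  have hrate0 : 0 ≤ η * x ^ n := by positivity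
  have hrate : η * x ^ n ≤ 1 := learningRate_mul_pow_le_one hx.le hxy hη.le hηy
  have main : ∀ t, r t ^ 2 ≤ (1 - η * x ^ n) ^ t * r 0 ^ 2 ∧
      (∀ j < n, frobNorm ((w t (j + 1))ᵀ * w t (j + 1) - w t j * (w t j)ᵀ)
        ≤ δ + 2 / 3 * η * (r 0 ^ 2 - r t ^ 2)) := by
    intro t
    induction t with
    | zero => simpa using hbal
    | succ t ih =>
      obtain ⟨ih1, ih2⟩ := ih
      have hle : r t ≤ r 0 := by
        refine le_of_sq_le_sq (ih1.trans ?_) (hr0 0)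
        exact mul_le_of_le_one_left (sq_nonneg _) (pow_le_one₀ (by linarith) (by linarith))
      have hbal2 : ∀ j < n, ‖(w t (j + 1))ᵀ * w t (j + 1) - w t j * (w t j)ᵀ‖ ≤ 2 * δ := by
        intro j hj
        refine (opNorm_le_frobNorm _).trans ((ih2 j hj).trans ?_)
        have h1 : r 0 ^ 2 ≤ f ^ 2 := pow_le_pow_left₀ (hr0 0) hE0 2
        have h2 : η * (r 0 ^ 2 - r t ^ 2) ≤ η * f ^ 2 := by
          gcongr
          linarith [sq_nonneg (r t)]
        have h3 : 0 ≤ η * f ^ 2 := by positivity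
        linarith
      have hprod : ‖layerSegment (w t) 0 (n + 1)‖ ≤ 2 * f := by
        have h1 := norm_add_le (layerSegment (w t) 0 (n + 1) - Φ) Φ
        rw [sub_add_cancel] at h1
        have h2 := opNorm_le_frobNorm (layerSegment (w t) 0 (n + 1) - Φ)
        have h3 := opNorm_le_frobNorm Φ
        have h4 : frobNorm (layerSegment (w t) 0 (n + 1) - Φ) ≤ f := hle.trans hE0
        linarith
      have hnorm := opNorm_sq_pow_le_of_balanced hy hyf (by linarith : 0 ≤ 2 * δ)
        (by linarith) hbal2 hprod
      have hdec := frobNorm_residual_step_sq_le hy hf hyf hη hηy hnorm (hle.trans hE0) (hstep t)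
      have hg := hgrad t hle hbal2 hnorm
      have hbstep := fun j (hj : j < n) => frobNorm_balance_step_le hj _ (hstep t)
      set S := ∑ j ∈ Finset.range (n + 1),
          frobNorm (layerGrad (w t) n (layerSegment (w t) 0 (n + 1) - Φ) j) ^ 2
      change r (t + 1) ^ 2 ≤ r t ^ 2 - 3 / 2 * η * S at hdec
      change 3 / 4 * x ^ n * r t ^ 2 ≤ S at hg
      constructor
      · have h1 := mul_le_mul_of_nonneg_left hg hη.le
        have h2 : 0 ≤ η * x ^ n * r t ^ 2 := by positivity
        calc r (t + 1) ^ 2 ≤ (1 - η * x ^ n) * r t ^ 2 := by linarith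
          _ ≤ (1 - η * x ^ n) * ((1 - η * x ^ n) ^ t * r 0 ^ 2) :=
              mul_le_mul_of_nonneg_left ih1 (by linarith)
          _ = _ := by ring
      · intro j hj
        have h1 := mul_le_mul_of_nonneg_left hdec hη.le
        linarith [hbstep j hj, ih2 j hj]
  exact (main T).1

end Convergence

/-! ### The smallest singular value as a lower bound -/

section SmallestSingularValue

open Module InnerProductSpace

variable {E F : Type*} [NormedAddCommGroup E] [InnerProductSpace ℝ E] [FiniteDimensional ℝ E]
  [NormedAddCommGroup F] [InnerProductSpace ℝ F] [FiniteDimensional ℝ F]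

theorem norm_sq_apply_eq_sum_singularValues (T : E →ₗ[ℝ] F) {n : ℕ} (hn : finrank ℝ E = n) (v : E) :
    ‖T v‖ ^ 2 = ∑ i : Fin n, T.singularValues i ^ 2 *
      ⟪T.isSymmetric_adjoint_comp_self.eigenvectorBasis hn i, v⟫_ℝ ^ 2 := by
  set b := T.isSymmetric_adjoint_comp_self.eigenvectorBasis hn
  rw [← real_inner_self_eq_norm_sq, ← LinearMap.adjoint_inner_right, ← b.sum_inner_mul_inner]
  refine Finset.sum_congr rfl fun i _ => ?_
  have h : ⟪b i, LinearMap.adjoint T (T v)⟫_ℝ = T.singularValues i ^ 2 * ⟪b i, v⟫_ℝ := by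
    have h1 := T.isSymmetric_adjoint_comp_self (b i) v
    rw [T.isSymmetric_adjoint_comp_self.apply_eigenvectorBasis hn i] at h1
    rw [T.sq_singularValues_fin hn]
    simpa [inner_smul_left] using h1.symm
  rw [h, real_inner_comm (b i) v]; ring

theorem singularValues_mul_norm_le_norm_apply (T : E →ₗ[ℝ] F) (v : E) :
    T.singularValues (finrank ℝ E - 1) * ‖v‖ ≤ ‖T v‖ := by
  refine le_of_sq_le_sq ?_ (norm_nonneg _)
  rw [norm_sq_apply_eq_sum_singularValues T rfl v, mul_pow,
    ← (T.isSymmetric_adjoint_comp_self.eigenvectorBasis rfl).sum_sq_norm_inner_right v,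
    Finset.mul_sum]
  refine Finset.sum_le_sum fun i _ => ?_
  rw [Real.norm_eq_abs, sq_abs]
  refine mul_le_mul_of_nonneg_right ?_ (sq_nonneg _)
  exact pow_le_pow_left₀ (T.singularValues_nonneg _) (T.singularValues_antitone (by omega)) 2

/-- If `dim F ≤ dim E` and the `dim F`-th singular value of `T : E → F` is positive, then it bounds
the adjoint of `T` from below: the images of the first `dim F` right singular vectors, normalized,
form an orthonormal basis of `F`. -/
theorem singularValues_mul_norm_le_norm_adjoint_apply (T : E →ₗ[ℝ] F)
    (hFE : finrank ℝ F ≤ finrank ℝ E) (hpos : 0 < T.singularValues (finrank ℝ F - 1)) (y : F) :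
    T.singularValues (finrank ℝ F - 1) * ‖y‖ ≤ ‖LinearMap.adjoint T y‖ := by
  set b := T.isSymmetric_adjoint_comp_self.eigenvectorBasis (rfl : finrank ℝ E = _)
  set e : Fin (finrank ℝ F) → E := fun i => b (Fin.castLE hFE i) with he
  have hσ : ∀ i : Fin (finrank ℝ F), T.singularValues (finrank ℝ F - 1) ≤ T.singularValues i :=
    fun i => T.singularValues_antitone (by omega)
  have heo : Orthonormal ℝ e := b.orthonormal.comp _ (Fin.castLE_injective hFE)
  have hTe : ∀ i j, ⟪T (e i), T (e j)⟫_ℝ = if i = j then T.singularValues i ^ 2 else 0 := by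
    intro i j
    rw [← LinearMap.adjoint_inner_left]
    have h1 := T.isSymmetric_adjoint_comp_self.apply_eigenvectorBasis rfl (Fin.castLE hFE i)
    rw [← T.sq_singularValues_fin rfl] at h1
    have h2 : LinearMap.adjoint T (T (e i)) = (T.singularValues i ^ 2) • e i := by
      exact h1
    rw [h2, real_inner_smul_left, orthonormal_iff_ite.1 heo i j]
    split_ifs <;> simp
  set g : Fin (finrank ℝ F) → F := fun i => (T.singularValues i)⁻¹ • T (e i) with hg
  have hgo : Orthonormal ℝ g := by
    rw [orthonormal_iff_ite]
    intro i j
    rw [hg, real_inner_smul_left, real_inner_smul_right, hTe]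
    have hi := hpos.trans_le (hσ i)
    split_ifs with h
    · subst h; field_simp
    · simp
  have hgspan : ⊤ ≤ Submodule.span ℝ (Set.range g) :=
    (hgo.linearIndependent.span_eq_top_of_card_eq_finrank' (by simp)).ge
  have hTy : ∀ i, ⟪e i, LinearMap.adjoint T y⟫_ℝ = T.singularValues i * ⟪g i, y⟫_ℝ := by
    intro i
    have hi := hpos.trans_le (hσ i)
    rw [LinearMap.adjoint_inner_right, hg, real_inner_smul_left, mul_inv_cancel_left₀ hi.ne']
  refine le_of_sq_le_sq ?_ (norm_nonneg _)
  have hbessel := heo.sum_inner_products_le (x := LinearMap.adjoint T y) (s := Finset.univ)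
  refine le_trans ?_ hbessel
  have hy := (OrthonormalBasis.mk hgo hgspan).sum_sq_norm_inner_right y
  simp only [OrthonormalBasis.coe_mk] at hy
  rw [mul_pow, ← hy, Finset.mul_sum]
  refine Finset.sum_le_sum fun i _ => ?_
  rw [hTy, norm_mul, mul_pow]
  refine mul_le_mul_of_nonneg_right ?_ (sq_nonneg _)
  rw [Real.norm_eq_abs, sq_abs]
  exact pow_le_pow_left₀ hpos.le (hσ i) 2

variable {m n : ℕ}

theorem sigmaMin_mul_norm_le_norm_mulVec (A : Matrix (Fin m) (Fin n) ℝ) (h : n ≤ m)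
    (v : Fin n → ℝ) : sigmaMin A * ‖WithLp.toLp 2 v‖ ≤ ‖WithLp.toLp 2 (A *ᵥ v)‖ := by
  have h1 := singularValues_mul_norm_le_norm_apply (Matrix.toEuclideanLin A) (WithLp.toLp 2 v)
  rw [finrank_euclideanSpace_fin] at h1
  rw [sigmaMin, min_eq_right h]
  exact h1

theorem sigmaMin_mul_norm_le_norm_transpose_mulVec (A : Matrix (Fin m) (Fin n) ℝ) (h : m ≤ n)
    (hA : 0 < sigmaMin A) (v : Fin m → ℝ) :
    sigmaMin A * ‖WithLp.toLp 2 v‖ ≤ ‖WithLp.toLp 2 (Aᵀ *ᵥ v)‖ := by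
  have hσ : sigmaMin A = (Matrix.toEuclideanLin A).singularValues
      (finrank ℝ (EuclideanSpace ℝ (Fin m)) - 1) := by
    rw [sigmaMin, min_eq_left h, finrank_euclideanSpace_fin]
  rw [hσ] at hA ⊢
  have h1 := singularValues_mul_norm_le_norm_adjoint_apply (Matrix.toEuclideanLin A) (by simpa)
    hA (WithLp.toLp 2 v)
  rw [← Matrix.toEuclideanLin_conjTranspose_eq_adjoint,
    conjTranspose_eq_transpose_of_trivial] at h1
  exact h1

theorem sigmaMin_le_frobNorm (A : Matrix (Fin m) (Fin n) ℝ) (hA : 0 < sigmaMin A) :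
    sigmaMin A ≤ frobNorm A := by
  have hpos : ∀ {a b : ℕ} (B : Matrix (Fin a) (Fin b) ℝ) (σ : ℝ), b ≠ 0 →
      (∀ v, σ * ‖WithLp.toLp 2 v‖ ≤ ‖WithLp.toLp 2 (B *ᵥ v)‖) → σ ≤ frobNorm B := by
    intro a b B σ hb h
    obtain ⟨i⟩ : Nonempty (Fin b) := ⟨⟨0, Nat.pos_of_ne_zero hb⟩⟩
    have hi : ‖WithLp.toLp 2 (Pi.single i 1 : Fin b → ℝ)‖ = 1 := by
      simp
    have h1 := (h (Pi.single i 1)).trans (norm_toLp_mulVec_le B _)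
    rw [hi, mul_one, mul_one] at h1
    exact h1.trans (opNorm_le_frobNorm B)
  have hmn : min m n ≠ 0 := by
    intro h0
    have h1 : A = 0 := by
      ext i j
      have := i.2
      have := j.2
      omega
    rw [sigmaMin, h1] at hA
    simp at hA
  rcases le_total m n with h | h
  · rw [← frobNorm_transpose]
    exact hpos Aᵀ _ (by omega) (sigmaMin_mul_norm_le_norm_transpose_mulVec A h hA)
  · exact hpos A _ (by omega) (sigmaMin_mul_norm_le_norm_mulVec A h)

/-- A matrix that is close to `Φ` inherits the lower bound of `Φ`. -/
theorem mul_norm_le_norm_mulVec_of_frobNorm_sub_le {A Φ : Matrix (Fin m) (Fin n) ℝ} {σ c : ℝ}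
    (hA : frobNorm (A - Φ) ≤ σ - c) {v : Fin n → ℝ}
    (hΦ : σ * ‖WithLp.toLp 2 v‖ ≤ ‖WithLp.toLp 2 (Φ *ᵥ v)‖) :
    c * ‖WithLp.toLp 2 v‖ ≤ ‖WithLp.toLp 2 (A *ᵥ v)‖ := by
  have h1 := norm_toLp_mulVec_le (A - Φ) v
  rw [sub_mulVec, WithLp.toLp_sub, norm_sub_rev] at h1
  have h2 := norm_sub_norm_le (WithLp.toLp 2 (Φ *ᵥ v)) (WithLp.toLp 2 (A *ᵥ v))
  have h3 := mul_le_mul_of_nonneg_right ((opNorm_le_frobNorm _).trans hA)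
    (norm_nonneg (WithLp.toLp 2 v))
  linarith

end SmallestSingularValue

/-! ### Padding to square matrices, and the gradient -/

section Padding

variable {d : ℕ → ℕ} {N M : ℕ}

/-- The isometric inclusion `ℝᵏ → ℝᴹ` as the first `k` coordinates, for `k ≤ M`. -/
def padIncl (M k : ℕ) : Matrix (Fin M) (Fin k) ℝ :=
  Matrix.of fun a b => if a.val = b.val then 1 else 0

theorem transpose_padIncl_mul_padIncl {M k : ℕ} (h : k ≤ M) :
    (padIncl M k)ᵀ * padIncl M k = 1 := by
  ext a b
  rw [Matrix.mul_apply, Finset.sum_eq_single (Fin.castLE h a)]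
  · simp [padIncl, Matrix.one_apply, Fin.ext_iff]
  · intro c _ hc
    have : c.val ≠ a.val := fun h' => hc (Fin.ext h')
    simp [padIncl, this]
  · simp

/-- The matrix `A`, padded with zeros to a square matrix of size `M`. -/
noncomputable def pad (M : ℕ) {k l : ℕ} (A : Matrix (Fin k) (Fin l) ℝ) :
    Matrix (Fin M) (Fin M) ℝ :=
  padIncl M k * A * (padIncl M l)ᵀ

/-- The orthogonal projection of `ℝᴹ` onto the first `k` coordinates. -/
noncomputable def padProj (M k : ℕ) : Matrix (Fin M) (Fin M) ℝ :=
  padIncl M k * (padIncl M k)ᵀ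

theorem transpose_padProj (M k : ℕ) : (padProj M k)ᵀ = padProj M k := by
  simp [padProj, transpose_mul]

theorem padProj_mul_padIncl {M k : ℕ} (h : k ≤ M) : padProj M k * padIncl M k = padIncl M k := by
  rw [padProj, Matrix.mul_assoc, transpose_padIncl_mul_padIncl h, Matrix.mul_one]

theorem transpose_padIncl_mul_padProj {M k : ℕ} (h : k ≤ M) :
    (padIncl M k)ᵀ * padProj M k = (padIncl M k)ᵀ := by
  rw [padProj, ← Matrix.mul_assoc, transpose_padIncl_mul_padIncl h, Matrix.one_mul]

theorem padProj_mul_padProj {M k : ℕ} (h : k ≤ M) : padProj M k * padProj M k = padProj M k := by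
  nth_rw 2 [padProj]
  rw [← Matrix.mul_assoc, padProj_mul_padIncl h, ← padProj]

theorem pad_mul {k l p : ℕ} (hl : l ≤ M) (A : Matrix (Fin k) (Fin l) ℝ)
    (B : Matrix (Fin l) (Fin p) ℝ) : pad M (A * B) = pad M A * pad M B := by
  simp only [pad]
  calc _ = padIncl M k * A * (1 : Matrix (Fin l) (Fin l) ℝ) * B * (padIncl M p)ᵀ := by
        simp only [Matrix.mul_assoc, Matrix.one_mul]
    _ = _ := by
        rw [← transpose_padIncl_mul_padIncl hl]
        simp only [Matrix.mul_assoc]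

theorem pad_sub {k l : ℕ} (A B : Matrix (Fin k) (Fin l) ℝ) :
    pad M (A - B) = pad M A - pad M B := by
  simp [pad, Matrix.mul_sub, Matrix.sub_mul]

theorem pad_add {k l : ℕ} (A B : Matrix (Fin k) (Fin l) ℝ) :
    pad M (A + B) = pad M A + pad M B := by
  simp [pad, Matrix.mul_add, Matrix.add_mul]

theorem pad_smul {k l : ℕ} (r : ℝ) (A : Matrix (Fin k) (Fin l) ℝ) :
    pad M (r • A) = r • pad M A := by
  simp [pad]

theorem pad_transpose {k l : ℕ} (A : Matrix (Fin k) (Fin l) ℝ) : pad M Aᵀ = (pad M A)ᵀ := by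
  simp [pad, transpose_mul, Matrix.mul_assoc]

theorem padProj_mul_pad {k l : ℕ} (hk : k ≤ M) (A : Matrix (Fin k) (Fin l) ℝ) :
    padProj M k * pad M A = pad M A := by
  rw [pad, ← Matrix.mul_assoc, ← Matrix.mul_assoc, padProj_mul_padIncl hk]

theorem pad_mul_padProj {k l : ℕ} (hl : l ≤ M) (A : Matrix (Fin k) (Fin l) ℝ) :
    pad M A * padProj M l = pad M A := by
  rw [pad, Matrix.mul_assoc, transpose_padIncl_mul_padProj hl]

theorem frobNorm_pad {k l : ℕ} (hk : k ≤ M) (hl : l ≤ M) (A : Matrix (Fin k) (Fin l) ℝ) :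
    frobNorm (pad M A) = frobNorm A := by
  refine (sq_eq_sq₀ (frobNorm_nonneg _) (frobNorm_nonneg _)).1 ?_
  rw [frobNorm_sq, frobNorm_sq, ← pad_transpose, ← pad_mul hk, pad, trace_mul_comm,
    ← Matrix.mul_assoc, transpose_padIncl_mul_padIncl hl, Matrix.one_mul]

theorem norm_toLp_padIncl_mulVec {k : ℕ} (hk : k ≤ M) (v : Fin k → ℝ) :
    ‖WithLp.toLp 2 (padIncl M k *ᵥ v)‖ = ‖WithLp.toLp 2 v‖ := by
  refine (sq_eq_sq₀ (norm_nonneg _) (norm_nonneg _)).1 ?_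
  rw [← dotProduct_self_eq_norm_sq, ← dotProduct_self_eq_norm_sq, dotProduct_mulVec,
    ← mulVec_transpose, mulVec_mulVec, transpose_padIncl_mul_padIncl hk, one_mulVec]

/-- A lower bound for `A` turns into one for the padded matrix, on the range of the projection. -/
theorem mul_norm_le_norm_pad_mulVec {k l : ℕ} (hk : k ≤ M) (hl : l ≤ M)
    {A : Matrix (Fin k) (Fin l) ℝ} {σ : ℝ}
    (hA : ∀ v, σ * ‖WithLp.toLp 2 v‖ ≤ ‖WithLp.toLp 2 (A *ᵥ v)‖) {v : Fin M → ℝ}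
    (hv : padProj M l *ᵥ v = v) :
    σ * ‖WithLp.toLp 2 v‖ ≤ ‖WithLp.toLp 2 (pad M A *ᵥ v)‖ := by
  have h := hA ((padIncl M l)ᵀ *ᵥ v)
  rw [← norm_toLp_padIncl_mulVec hl, ← norm_toLp_padIncl_mulVec hk, mulVec_mulVec, ← padProj, hv,
    mulVec_mulVec, mulVec_mulVec, ← pad] at h
  exact h

/-- The layers of a network, padded to square matrices of size `M`, and continued by `0` beyond the
depth. -/
noncomputable def padLayers (M : ℕ) (W : Weights d N) (j : ℕ) : Matrix (Fin M) (Fin M) ℝ :=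
  if h : j < N then pad M (W ⟨j, h⟩) else 0

theorem padLayers_of_lt (W : Weights d N) {j : ℕ} (h : j < N) :
    padLayers M W j = pad M (W ⟨j, h⟩) := by
  simp [padLayers, h]

theorem pad_layerProd (hd : ∀ i ≤ N, d i ≤ M) (W : Weights d N) (k : ℕ) (hk : k ≤ N) :
    pad M (layerProd W k hk) = layerSegment (padLayers M W) 0 k * padProj M (d 0) := by
  induction k with
  | zero => simp [layerProd, layerSegment, pad, padProj]
  | succ k ih =>
    rw [layerProd, pad_mul (hd k (by omega)), ih, layerSegment_succ_right _ k.zero_le,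
      padLayers_of_lt W (show k < N by omega), Matrix.mul_assoc]

theorem pad_endToEnd {n : ℕ} (hd : ∀ i ≤ n + 1, d i ≤ M) (W : Weights d (n + 1)) :
    pad M (endToEnd W) = layerSegment (padLayers M W) 0 (n + 1) := by
  rw [endToEnd, pad_layerProd hd, layerSegment_succ_left _ n.succ_pos, Matrix.mul_assoc,
    padLayers_of_lt W n.succ_pos]
  congr 1
  exact pad_mul_padProj (hd 0 (by omega)) _

theorem frobNorm_endToEnd_sub {n : ℕ} (hd : ∀ i ≤ n + 1, d i ≤ M)
    (Φ : Matrix (Fin (d (n + 1))) (Fin (d 0)) ℝ) (W : Weights d (n + 1)) :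
    frobNorm (endToEnd W - Φ)
      = frobNorm (layerSegment (padLayers M W) 0 (n + 1) - pad M Φ) := by
  rw [← frobNorm_pad (hd _ le_rfl) (hd 0 (by omega)), pad_sub, pad_endToEnd hd]

theorem padLayers_update_of_ne (W : Weights d N) (j : Fin N) (X) {i : ℕ} (hi : i ≠ j) :
    padLayers M (Function.update W j X) i = padLayers M W i := by
  unfold padLayers
  split_ifs with h
  · rw [Function.update_of_ne]
    exact fun h' => hi (congrArg Fin.val h')
  · rfl

theorem padLayers_update_self (W : Weights d N) (j : Fin N) (X) :
    padLayers M (Function.update W j X) j = pad M X := by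
  rw [padLayers_of_lt _ j.2, Fin.eta, Function.update_self]

/-- The end-to-end matrix is affine in each single layer. -/
theorem layerSegment_padLayers_update {n : ℕ} (W : Weights d (n + 1)) (j : Fin (n + 1)) (X) :
    layerSegment (padLayers M (Function.update W j (W j + X))) 0 (n + 1)
      = layerSegment (padLayers M W) 0 (n + 1)
        + layerSegment (padLayers M W) (j + 1) (n + 1) * pad M X
          * layerSegment (padLayers M W) 0 j := by
  rw [← sub_eq_iff_eq_add', layerSegment_sub_layerSegment, Finset.sum_eq_single j.val]
  · rw [padLayers_update_self, padLayers_of_lt W j.2, Fin.eta, pad_add, add_sub_cancel_left]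
    congr 1
    exact layerSegment_congr fun i _ hi => padLayers_update_of_ne W j _ hi.ne
  · intro i _ hi
    rw [padLayers_update_of_ne W j _ hi, sub_self, mul_zero, zero_mul]
  · intro h
    exact absurd (Finset.mem_range.2 j.2) h

theorem hasDerivAt_half_mul_frobNorm_add_smul_sq (E X : Matrix (Fin M) (Fin M) ℝ) :
    HasDerivAt (fun s : ℝ => 1 / 2 * frobNorm (E + s • X) ^ 2) (Eᵀ * X).trace 0 := by
  have e : (fun s : ℝ => 1 / 2 * frobNorm (E + s • X) ^ 2)
      = fun s => 1 / 2 * (frobNorm E ^ 2 + s * (2 * (Eᵀ * X).trace) + s ^ 2 * frobNorm X ^ 2) := by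
    funext s
    rw [frobNorm_add_sq, frobNorm_smul, mul_pow, sq_abs, mul_smul_comm, trace_smul, smul_eq_mul]
    ring
  rw [e]
  have h1 := ((hasDerivAt_id (0 : ℝ)).mul_const (2 * (Eᵀ * X).trace)).const_add (frobNorm E ^ 2)
  have h2 := ((hasDerivAt_id (0 : ℝ)).pow 2).mul_const (frobNorm X ^ 2)
  have h3 := (h1.add h2).const_mul (1 / 2)
  exact h3.congr_deriv (by simp)

theorem lossGrad_eq {n : ℕ} (hd : ∀ i ≤ n + 1, d i ≤ M)
    (Φ : Matrix (Fin (d (n + 1))) (Fin (d 0)) ℝ) (W : Weights d (n + 1)) (j : Fin (n + 1)) :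
    lossGrad Φ W j = (padIncl M (d (j + 1)))ᵀ * layerGrad (padLayers M W) n
      (layerSegment (padLayers M W) 0 (n + 1) - pad M Φ) j * padIncl M (d j) := by
  set w := padLayers M W with hw
  set E := layerSegment w 0 (n + 1) - pad M Φ with hE
  ext a b
  rw [lossGrad, Matrix.of_apply]
  set X : Matrix (Fin (d (j + 1))) (Fin (d j)) ℝ := Matrix.single a b 1 with hX
  have h1 : (fun s : ℝ => loss Φ (Function.update W j (W j + s • X)))
      = fun s => 1 / 2 * frobNorm (E
          + s • (layerSegment w (j + 1) (n + 1) * pad M X * layerSegment w 0 j)) ^ 2 := by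
    funext s
    rw [loss, frobNorm_endToEnd_sub hd, layerSegment_padLayers_update, pad_smul, mul_smul_comm,
      smul_mul_assoc, hE, ← hw]
    congr 3
    abel
  rw [h1, (hasDerivAt_half_mul_frobNorm_add_smul_sq _ _).deriv]
  have h2 : (Eᵀ * (layerSegment w (j + 1) (n + 1) * pad M X * layerSegment w 0 j)).trace
      = (((padIncl M (d (j + 1)))ᵀ * layerGrad w n E j * padIncl M (d j))ᵀ * X).trace := by
    simp only [layerGrad, pad, transpose_mul, transpose_transpose]
    simp only [Matrix.mul_assoc]
    rw [trace_mul_comm (padIncl M (d j))ᵀ, Matrix.mul_assoc (layerSegment w 0 j),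
      trace_mul_comm (layerSegment w 0 j)]
    simp only [Matrix.mul_assoc]
  rw [h2, hX]
  simp [Matrix.trace_mul_single, -transpose_mul]

theorem pad_lossGrad {n : ℕ} (hd : ∀ i ≤ n + 1, d i ≤ M)
    (Φ : Matrix (Fin (d (n + 1))) (Fin (d 0)) ℝ) (W : Weights d (n + 1)) (j : Fin (n + 1)) :
    pad M (lossGrad Φ W j) = layerGrad (padLayers M W) n
      (layerSegment (padLayers M W) 0 (n + 1) - pad M Φ) j := by
  rw [lossGrad_eq hd]
  set w := padLayers M W with hw
  have hE : ∃ E₀ : Matrix (Fin (d (n + 1))) (Fin (d 0)) ℝ,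
      layerSegment w 0 (n + 1) - pad M Φ = pad M E₀ :=
    ⟨endToEnd W - Φ, by rw [pad_sub, pad_endToEnd hd]⟩
  obtain ⟨E₀, hE₀⟩ := hE
  rw [hE₀]
  have hA : padProj M (d (j + 1)) * ((layerSegment w (j + 1) (n + 1))ᵀ * pad M E₀)
      = (layerSegment w (j + 1) (n + 1))ᵀ * pad M E₀ := by
    rcases Nat.lt_or_ge (j + 1) (n + 1) with h | h
    · rw [layerSegment_succ_left w h, transpose_mul, hw, padLayers_of_lt W h, ← pad_transpose,
        ← Matrix.mul_assoc, ← Matrix.mul_assoc, padProj_mul_pad (hd _ (by omega))]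
    · have hj : j.val = n := by omega
      rw [layerSegment_of_le w h, transpose_one, Matrix.one_mul, hj]
      exact padProj_mul_pad (hd _ le_rfl) _
  have hB : pad M E₀ * (layerSegment w 0 j)ᵀ * padProj M (d j)
      = pad M E₀ * (layerSegment w 0 j)ᵀ := by
    rcases Nat.eq_zero_or_pos j.val with h | h
    · rw [h, layerSegment_of_le w le_rfl, transpose_one, Matrix.mul_one]
      exact pad_mul_padProj (hd _ (by omega)) _
    · obtain ⟨i, hi⟩ : ∃ i, j.val = i + 1 := ⟨j.val - 1, by omega⟩
      rw [hi, layerSegment_succ_right w i.zero_le, transpose_mul, hw,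
        padLayers_of_lt W (show i < n + 1 by omega), ← pad_transpose, Matrix.mul_assoc,
        Matrix.mul_assoc]
      congr 2
      exact pad_mul_padProj (hd _ (by omega)) _
  have e : pad M ((padIncl M (d (j + 1)))ᵀ * layerGrad w n (pad M E₀) j * padIncl M (d j))
      = padProj M (d (j + 1)) * layerGrad w n (pad M E₀) j * padProj M (d j) := by
    generalize layerGrad w n (pad M E₀) j = G
    simp only [pad, padProj, Matrix.mul_assoc]
  rw [e, layerGrad, ← Matrix.mul_assoc, hA, Matrix.mul_assoc _ (pad M E₀), Matrix.mul_assoc, hB]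

end Padding

/-! ### Convergence of gradient descent -/

section MainTheorem

/-- The gradient dominates the residual at nearly balanced weights with a deficiency margin. On the
narrower of the two ends of the network, the end-to-end matrix has full rank, and it suffices to
consider the gradient of the layer at the opposite end. -/
theorem le_sum_frobNorm_layerGrad_sq {d : ℕ → ℕ} {n M : ℕ} (hd : ∀ i ≤ n + 1, d i ≤ M)
    {Φ : Matrix (Fin (d (n + 1))) (Fin (d 0)) ℝ} {W : Weights d (n + 1)} {c x y δ : ℝ} (hc : 0 < c)
    (hσ : 0 < sigmaMin Φ) (hmargin : frobNorm (endToEnd W - Φ) ≤ sigmaMin Φ - c)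
    (hxc : x ^ (n + 1) = c ^ 2) (hx : 0 < x) (hxy : x ≤ y) (hδ : 0 ≤ δ)
    (hδx : 128 * (n + 1) ^ 3 * y ^ n * δ ≤ x ^ (n + 1))
    (hbal : ∀ j < n, ‖(padLayers M W (j + 1))ᵀ * padLayers M W (j + 1)
      - padLayers M W j * (padLayers M W j)ᵀ‖ ≤ δ)
    (hw : ∀ j ≤ n, (‖padLayers M W j‖ ^ 2) ^ (n + 1) ≤ 16 * y ^ (n + 1)) :
    3 / 4 * x ^ n * frobNorm (layerSegment (padLayers M W) 0 (n + 1) - pad M Φ) ^ 2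
      ≤ ∑ j ∈ Finset.range (n + 1), frobNorm (layerGrad (padLayers M W) n
          (layerSegment (padLayers M W) 0 (n + 1) - pad M Φ) j) ^ 2 := by
  rw [frobNorm_endToEnd_sub hd] at hmargin
  have hE : layerSegment (padLayers M W) 0 (n + 1) - pad M Φ = pad M (endToEnd W - Φ) := by
    rw [pad_sub, pad_endToEnd hd]
  have hN := hd (n + 1) le_rfl
  have h0 := hd 0 (by omega)
  have hsq : ∀ {A : Matrix (Fin M) (Fin M) ℝ} {v : Fin M → ℝ},
      c * ‖WithLp.toLp 2 v‖ ≤ ‖WithLp.toLp 2 (A *ᵥ v)‖ →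
      x ^ (n + 1) * (v ⬝ᵥ v) ≤ A *ᵥ v ⬝ᵥ A *ᵥ v := by
    intro A v h
    rw [hxc, dotProduct_self_eq_norm_sq, dotProduct_self_eq_norm_sq, ← mul_pow]
    exact pow_le_pow_left₀ (by positivity) h 2
  set w := padLayers M W with hwdef
  set E := layerSegment w 0 (n + 1) - pad M Φ with hEdef
  have hterm : ∀ j ≤ n, frobNorm (layerGrad w n E j) ^ 2
      ≤ ∑ j ∈ Finset.range (n + 1), frobNorm (layerGrad w n E j) ^ 2 := fun j hj =>
    Finset.single_le_sum (f := fun j => frobNorm (layerGrad w n E j) ^ 2)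
      (fun _ _ => sq_nonneg _) (Finset.mem_range.2 (by omega))
  rcases le_total (d (n + 1)) (d 0) with h | h
  · refine le_trans ?_ (hterm 0 (Nat.zero_le n))
    have h1 := le_frobNorm_transpose_layerSegment_mul (w := w) (P := padProj M (d (n + 1)))
      (X := E) (transpose_padProj _ _) (padProj_mul_padProj hN)
      (by rw [hwdef, padLayers_of_lt W n.lt_succ_self]; exact padProj_mul_pad hN _)
      hx hxy hδ hδx hbal hw
      (fun v hv => hsq (mul_norm_le_norm_mulVec_of_frobNorm_sub_le (Φ := (pad M Φ)ᵀ)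
        (by rwa [← transpose_sub, frobNorm_transpose])
        (by
          rw [← pad_transpose]
          exact mul_norm_le_norm_pad_mulVec h0 hN
            (sigmaMin_mul_norm_le_norm_transpose_mulVec Φ h hσ) hv)))
      (by rw [hE]; exact padProj_mul_pad hN _)
    rwa [layerGrad, layerSegment_of_le w le_rfl, transpose_one, mul_one]
  · refine le_trans ?_ (hterm n le_rfl)
    have h1 := le_frobNorm_mul_transpose_layerSegment (w := w) (P := padProj M (d 0))
      (X := E) (transpose_padProj _ _) (padProj_mul_padProj h0)
      (by rw [hwdef, padLayers_of_lt W n.succ_pos]; exact pad_mul_padProj h0 _)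
      hx hxy hδ hδx hbal hw
      (fun v hv => hsq (mul_norm_le_norm_mulVec_of_frobNorm_sub_le (Φ := pad M Φ) hmargin
        (mul_norm_le_norm_pad_mulVec hN h0 (sigmaMin_mul_norm_le_norm_mulVec Φ h) hv)))
      (by rw [hE]; exact pad_mul_padProj h0 _)
    rwa [layerGrad, layerSegment_of_le w le_rfl, transpose_one, one_mul]

theorem rpow_eq_rpow_two_div_pow {a N e : ℝ} (ha : 0 ≤ a) (k : ℕ) (he : e = 2 * k / N) :
    a ^ e = (a ^ (2 / N)) ^ k := by
  rw [← Real.rpow_natCast, ← Real.rpow_mul ha, he]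
  congr 1
  ring

/-- The hypotheses on `δ` and `η`, in terms of `x = c ^ (2 / N)` and `y = ‖Φ‖_F ^ (2 / N)`. -/
theorem balance_and_learningRate_bounds {n : ℕ} {x y η δ : ℝ} (hx : 0 < x) (hxy : x ≤ y)
    (hη : η ≤ x ^ (2 * n + 1) / (6144 * ((n : ℝ) + 1) ^ 3 * y ^ (3 * n + 1)))
    (hδ : δ = x ^ (n + 1) / (256 * ((n : ℝ) + 1) ^ 3 * y ^ n)) :
    6144 * ((n : ℝ) + 1) ^ 3 * y ^ n * η ≤ 1 ∧ 256 * ((n : ℝ) + 1) ^ 3 * y ^ n * δ = x ^ (n + 1) ∧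
      256 * ((n : ℝ) + 1) ^ 3 * δ ≤ y ∧ η * y ^ (n + 1) ≤ δ := by
  have hy : 0 < y := hx.trans_le hxy
  have hN : (0 : ℝ) < (n : ℝ) + 1 := by positivity
  have hδ' : 256 * ((n : ℝ) + 1) ^ 3 * y ^ n * δ = x ^ (n + 1) := by
    rw [hδ]; field_simp
  have hη' : 6144 * ((n : ℝ) + 1) ^ 3 * y ^ (3 * n + 1) * η ≤ x ^ (2 * n + 1) := by
    rwa [le_div_iff₀ (by positivity), mul_comm] at hη
  refine ⟨?_, hδ', ?_, ?_⟩
  · refine le_of_mul_le_mul_right ?_ (pow_pos hy (2 * n + 1))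
    calc _ = 6144 * ((n : ℝ) + 1) ^ 3 * y ^ (3 * n + 1) * η := by ring
      _ ≤ x ^ (2 * n + 1) := hη'
      _ ≤ y ^ (2 * n + 1) := by gcongr
      _ = _ := (one_mul _).symm
  · refine le_of_mul_le_mul_right ?_ (pow_pos hy n)
    calc _ = 256 * ((n : ℝ) + 1) ^ 3 * y ^ n * δ := by ring
      _ = x ^ (n + 1) := hδ'
      _ ≤ y ^ (n + 1) := by gcongr
      _ = y * y ^ n := pow_succ' y n
  · refine le_of_mul_le_mul_left ?_ (show 0 < 6144 * ((n : ℝ) + 1) ^ 3 * y ^ (2 * n) by positivity)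
    calc _ = 6144 * ((n : ℝ) + 1) ^ 3 * y ^ (3 * n + 1) * η := by ring
      _ ≤ x ^ (2 * n + 1) := hη'
      _ = x ^ n * x ^ (n + 1) := by ring
      _ ≤ y ^ n * x ^ (n + 1) := by gcongr
      _ ≤ y ^ n * (24 * x ^ (n + 1)) := by
          gcongr
          linarith [pow_pos hx (n + 1)]
      _ = _ := by rw [← hδ']; ring

theorem theorem1 (N : ℕ) (hN : 1 ≤ N) (d : ℕ → ℕ) (Φ : Matrix (Fin (d N)) (Fin (d 0)) ℝ)
    (c η : ℝ) (hc : 0 < c) (hη : 0 < η) (W : ℕ → Weights d N)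
    (hGD : IsGradientDescent Φ η W)
    (hmargin : HasDeficiencyMargin c Φ (endToEnd (W 0)))
    (hbal : IsBalanced
      (c ^ 2 / (256 * (N : ℝ) ^ 3 * frobNorm Φ ^ (2 * ((N : ℝ) - 1) / (N : ℝ)))) (W 0))
    (hη_le : η ≤ c ^ ((4 * (N : ℝ) - 2) / (N : ℝ)) /
      (6144 * (N : ℝ) ^ 3 * frobNorm Φ ^ ((6 * (N : ℝ) - 4) / (N : ℝ))))
    (ε : ℝ) (hε : 0 < ε) (T : ℕ)
    (hT : 1 / (η * c ^ (2 * ((N : ℝ) - 1) / (N : ℝ))) * Real.log (loss Φ (W 0) / ε) ≤ (T : ℝ)) :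
    loss Φ (W T) ≤ ε := by
  obtain ⟨n, rfl⟩ : ∃ n, N = n + 1 := ⟨N - 1, by omega⟩
  rw [HasDeficiencyMargin] at hmargin
  have hcσ : c ≤ sigmaMin Φ := by linarith [frobNorm_nonneg (endToEnd (W 0) - Φ)]
  have hσ : 0 < sigmaMin Φ := hc.trans_le hcσ
  set f := frobNorm Φ with hf
  have hσf : sigmaMin Φ ≤ f := sigmaMin_le_frobNorm Φ hσ
  have hcf : c ≤ f := hcσ.trans hσf
  have hf0 : 0 < f := hc.trans_le hcf
  -- with `x` and `y`, all real powers become natural powers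
  set x := c ^ (2 / ((n + 1 : ℕ) : ℝ)) with hxdef
  set y := f ^ (2 / ((n + 1 : ℕ) : ℝ)) with hydef
  have hx : 0 < x := Real.rpow_pos_of_pos hc _
  have hxy : x ≤ y := Real.rpow_le_rpow hc.le hcf (by positivity)
  have hN0 : ((n + 1 : ℕ) : ℝ) ≠ 0 := by positivity
  have hcast : ((n + 1 : ℕ) : ℝ) = (n : ℝ) + 1 := by push_cast; rfl
  have hxc : x ^ (n + 1) = c ^ 2 := by
    rw [← rpow_eq_rpow_two_div_pow hc.le (n + 1) (e := 2) (by field_simp), Real.rpow_two]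
  have hyf : y ^ (n + 1) = f ^ 2 := by
    rw [← rpow_eq_rpow_two_div_pow hf0.le (n + 1) (e := 2) (by field_simp), Real.rpow_two]
  have he : 2 * (((n + 1 : ℕ) : ℝ) - 1) / ((n + 1 : ℕ) : ℝ) = 2 * (n : ℝ) / ((n + 1 : ℕ) : ℝ) := by
    rw [hcast]; ring
  rw [rpow_eq_rpow_two_div_pow hf0.le n he, ← hydef, ← hxc] at hbal
  rw [rpow_eq_rpow_two_div_pow hc.le n he, ← hxdef] at hT
  rw [rpow_eq_rpow_two_div_pow (N := ((n + 1 : ℕ) : ℝ)) hc.le (2 * n + 1) (by push_cast; ring),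
    ← hxdef,
    rpow_eq_rpow_two_div_pow (N := ((n + 1 : ℕ) : ℝ)) hf0.le (3 * n + 1) (by push_cast; ring),
    ← hydef] at hη_le
  rw [hcast] at hbal hη_le
  set δ := x ^ (n + 1) / (256 * ((n : ℝ) + 1) ^ 3 * y ^ n) with hδ
  obtain ⟨hηy, hδx, hδy, hηδ⟩ := balance_and_learningRate_bounds hx hxy hη_le hδ
  have hy : 0 < y := hx.trans_le hxy
  have hδ0 : 0 ≤ δ := by positivity
  set M := ∑ i ∈ Finset.range (n + 2), d i with hM
  have hd : ∀ i ≤ n + 1, d i ≤ M := fun i hi =>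
    Finset.single_le_sum (f := d) (fun _ _ => Nat.zero_le _) (Finset.mem_range.2 (by omega))
  have hres := fun t => frobNorm_endToEnd_sub hd Φ (W t)
  have main := frobNorm_residual_sq_le_pow_mul (w := fun t => padLayers M (W t)) (Φ := pad M Φ)
    hx hxy hf0.le hyf hη hηy hδ0 hδy (by rwa [hyf] at hηδ)
    (by rw [frobNorm_pad (hd _ le_rfl) (hd 0 (by omega))])
    (by rw [← hres]; linarith)
    (by
      intro j hj
      have h1 := hbal j (by omega)
      rw [← frobNorm_pad (hd _ (by omega)) (hd _ (by omega)), pad_sub, pad_mul (hd _ (by omega)),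
        pad_mul (hd _ (by omega)), pad_transpose, pad_transpose] at h1
      rw [padLayers_of_lt _ (show j + 1 < n + 1 by omega),
        padLayers_of_lt _ (show j < n + 1 by omega)]
      exact h1)
    (by
      intro t j hj
      have hj' : j < n + 1 := by omega
      have h1 := congrArg (pad M) (hGD t ⟨j, hj'⟩)
      rw [pad_sub, pad_smul, pad_lossGrad hd] at h1
      rw [padLayers_of_lt _ hj', padLayers_of_lt _ hj']
      exact h1)
    (by
      intro t hle hb hw
      rw [← hres, ← hres] at hle
      exact le_sum_frobNorm_layerGrad_sq hd hc hσ (hle.trans hmargin) hxc hx hxy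
        (by positivity) (by linarith) hb hw)
    T
  have hrate : 0 < η * x ^ n := by positivity
  have hloss : loss Φ (W T) ≤ (1 - η * x ^ n) ^ T * loss Φ (W 0) := by
    simp only [loss, hres]
    linarith
  have hl0 : 0 ≤ loss Φ (W 0) := by unfold loss; positivity
  have hexp : (1 - η * x ^ n) ^ T ≤ Real.exp (-(η * x ^ n * T)) := by
    have h1 : 1 - η * x ^ n ≤ Real.exp (-(η * x ^ n)) := by
      linarith [Real.add_one_le_exp (-(η * x ^ n))]
    have h2 : 0 ≤ 1 - η * x ^ n := sub_nonneg.2 (learningRate_mul_pow_le_one hx.le hxy hη.le hηy)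
    calc _ ≤ Real.exp (-(η * x ^ n)) ^ T := pow_le_pow_left₀ h2 h1 T
      _ = _ := by rw [← Real.exp_nat_mul]; congr 1; ring
  rcases hl0.eq_or_lt with h0 | hpos
  · rw [← h0, mul_zero] at hloss
    exact hloss.trans hε.le
  · rw [one_div, inv_mul_le_iff₀ hrate] at hT
    calc loss Φ (W T) ≤ Real.exp (-(η * x ^ n * T)) * loss Φ (W 0) :=
          hloss.trans (mul_le_mul_of_nonneg_right hexp hl0)
      _ ≤ Real.exp (-Real.log (loss Φ (W 0) / ε)) * loss Φ (W 0) := by gcongr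
      _ = ε := by
          rw [Real.exp_neg, Real.exp_log (by positivity)]
          field_simp

end MainTheorem
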